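/- **Setting.** Let $d\ge 1$, let $V=\{v\in\mathbb Z^d:|v|\le 1\}$ with $|\cdot|$ the Euclidean norm, let $\mathcal M$ be the space of probability measures on $V$, and $\Omega=\mathcal M^{\mathbb Z^d}$ with its Borel $\sigma$-field. For $\omega=(\omega(x,v))_{x\in\mathbb Z^d,v\in V}\in\Omega$ and $x\in\mathbb Z^d$, let $P_\omega^x$ be the law of the Markov chain $(X_n)_{n\ge0}$ on $\mathbb Z^d$ with $X_0=x$ and transition probabilities $P_\omega^x(X_{n+1}=y+v\mid X_n=y)=\omega(y,v)$. For a probability measure $P$ on $\Omega$, let $\mathbb P(F\times G)=\int_F P_\omega^{o}(G)\,P(d\omega)$ be the annealed law of the walk started at the origin $o$. Write $\omega_x=(\omega(x,v))_{v\in V}$, $\mathcal F_\Lambda=\sigma(\omega_x:x\in\Lambda)$, $d(\cdot,\cdot)$ for the $\ell^1$-distance, and $\partial_rW=\{x\notin W: d(x,W)\le r\}$. $P$ is *translation invariant* if it is preserved by all shifts $\theta^y$, $(\theta^y\omega)_x=\omega_{x+y}$. It is *uniformly elliptic* if for some $\kappa>0$, $P$-a.s., $\omega(x,e)>\kappa$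 for all $x\in\mathbb Z^d$ and all $e$ with $|e|=1$. It *satisfies (G)* if there is an integer $r\ge1$ such that 1. ($r$-Markov) for every finite $W\subset\mathbb Z^d$, $P\big((\omega_x)_{x\in W}\in\cdot\mid\mathcal F_{W^c}\big)=P\big((\omega_x)_{x\in W}\in\cdot\mid\mathcal F_{\partial_rW}\big)$, $P$-a.s.; and 2. there are constants $\gamma,C\in(0,\infty)$ such that for all finite $\Delta\subset W\subset\mathbb Z^d$ with $d(\Delta,W^c)\ge r$ and all $A\subset W^c$, $$\frac{dP\big((\omega_x)_{x\in\Delta}\in\cdot\mid\eta\big)}{dP\big((\omega_x)_{x\in\Delta}\in\cdot\mid\eta'\big)}\le\exp\Big(C\sum_{x\in A,\,y\in\Delta}e^{-\gamma d(x,y)}\Big)$$ for all $\eta,\eta'$ in some set of full $P$-measure of configurations in $\mathcal M^{W^c}$ (which may depend on $\Delta,W,A$) that agree on $W^c\setminus A$. Here $P(\cdot\mid\eta)$ is the regular conditional distribution given $(\omega_x)_{x\in W^c}=\eta$. For a path $X_\cdot$ and an integer $j\ge0$, let $\mathcal H_j=\{x: x\cdot e_1=X_0\cdot e_1+j\}$,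 let $D=\inf\{n\ge1:X_n\cdot e_1\le X_0\cdot e_1\}$, and for $c>0$ let $$R_c=\inf\Big\{n\ge0:\ \sum_{i=0}^n 1_{X_i\in\mathcal H_j}>c(j+1)^2\ \text{for some } j\ge0\Big\}\wedge D,\qquad \inf\emptyset=\infty .$$ **Theorem.** Suppose that $P$ is translation invariant, uniformly elliptic and satisfies (G). If $\mathbb P\big(\limsup_{n\to\infty}X_n\cdot e_1/n>0\big)>0$, then there is a constant $c_5>0$ such that $$\mathbb P(R_{c_5}=\infty)>0 .$$ That is, with positive annealed probability the walk never returns to or goes below its starting level after time $0$, and, on the same event, for every $j\ge0$ it visits $\mathcal H_j$ at most $c_5(j+1)^2$ times in total. -/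

import Mathlib

open MeasureTheory ProbabilityTheory Filter
open scoped ENNReal

namespace RWRE

noncomputable section

/-- The lattice `ℤ^d`, with the product measurable structure (all subsets are measurable). -/
abbrev Site (d : ℕ) : Type := Fin d → ℤ

/-- The finite set of admissible steps `{v ∈ ℤ^d : |v| ≤ 1}` for the Euclidean norm (an integer
vector of Euclidean norm at most one has its coordinates in `[-1, 1]`, see `mem_steps`). -/
def steps (d : ℕ) : Finset (Site d) :=
  (Finset.Icc (fun _ => -1) (fun _ => 1)).filter (fun v => ∑ i, v i ^ 2 ≤ 1)

theorem mem_steps {d : ℕ} (v : Site d) : v ∈ steps d ↔ ∑ i, v i ^ 2 ≤ 1 := by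
  simp only [steps, Finset.mem_filter, and_iff_right_iff_imp, Finset.mem_Icc, Pi.le_def]
  intro h
  have h1 : ∀ i, v i ^ 2 ≤ 1 := fun i =>
    (Finset.single_le_sum (f := fun i => v i ^ 2) (fun j _ => sq_nonneg _)
      (Finset.mem_univ i)).trans h
  exact ⟨fun i => (abs_le.mp (sq_le_one_iff_abs_le_one _ |>.mp (h1 i))).1,
    fun i => (abs_le.mp (sq_le_one_iff_abs_le_one _ |>.mp (h1 i))).2⟩

instance instNonemptySteps (d : ℕ) : Nonempty (steps d) :=
  ⟨⟨0, (mem_steps 0).mpr (by simp)⟩⟩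

/-- Probability measures on the finite set of steps, as probability vectors. Its Borel structure
is the one inherited from `ℝ^V`. -/
abbrev StepLaw (d : ℕ) : Type := stdSimplex ℝ (steps d)

instance instStandardBorelStepLaw (d : ℕ) : StandardBorelSpace (StepLaw d) :=
  (isClosed_stdSimplex ℝ (steps d)).measurableSet.standardBorel

/-- Environments: `ω x v` is the probability of the step `v` at the site `x`. -/
abbrev Env (d : ℕ) : Type := Site d → StepLaw d

/-! ### The walk -/

/-- One-step transition of the walk in the environment `ω`: from `y` to `y + v` with
probability `ω y v`. -/
def stepKernel {d : ℕ} (ω : Env d) : Kernel (Site d) (Site d) where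
  toFun y := ∑ v : steps d, ENNReal.ofReal (ω y v) • Measure.dirac (y + (v : Site d))
  measurable' := Measurable.of_discrete

instance instIsMarkovKernelStepKernel {d : ℕ} (ω : Env d) : IsMarkovKernel (stepKernel ω) where
  isProbabilityMeasure y := ⟨by
    change (∑ v : steps d, ENNReal.ofReal (ω y v) • Measure.dirac (y + (v : Site d))) Set.univ = 1
    simp only [Measure.coe_finsetSum, Finset.sum_apply, Measure.smul_apply, measure_univ,
      smul_eq_mul, mul_one]
    have hsum : ∑ v, ω y v = 1 := (ω y).2.2
    have hnn : ∀ v ∈ Finset.univ, 0 ≤ ω y v := fun v _ => (ω y).2.1 v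
    rw [← ENNReal.ofReal_sum_of_nonneg hnn, hsum, ENNReal.ofReal_one]⟩

/-- The transition at time `n`, as a kernel from the past up to time `n`: the Markov property. -/
def historyKernel {d : ℕ} (ω : Env d) (n : ℕ) :
    Kernel ((i : Finset.Iic n) → Site d) (Site d) :=
  (stepKernel ω).comap (fun h => h ⟨n, Finset.mem_Iic.mpr le_rfl⟩) (measurable_pi_apply _)

instance instIsMarkovKernelHistoryKernel {d : ℕ} (ω : Env d) (n : ℕ) :
    IsMarkovKernel (historyKernel ω n) := by
  unfold historyKernel; infer_instance

/-- The quenched law `P_ω^x` on paths: the law of the Markov chain with transitions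
`stepKernel ω` started at `x`, built by the Ionescu-Tulcea theorem. -/
def quenchedLaw {d : ℕ} (x : Site d) (ω : Env d) : Measure (ℕ → Site d) :=
  Kernel.traj (X := fun _ => Site d) (historyKernel ω) 0 (fun _ => x)

instance instIsProbabilityMeasureQuenchedLaw {d : ℕ} (x : Site d) (ω : Env d) :
    IsProbabilityMeasure (quenchedLaw x ω) := by
  unfold quenchedLaw; infer_instance

theorem measurable_stepKernel {d : ℕ} (y : Site d) :
    Measurable (fun ω : Env d => stepKernel ω y) := by
  refine Measure.measurable_of_measurable_coe _ fun s hs => ?_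
  change Measurable fun ω : Env d =>
    (∑ v : steps d, ENNReal.ofReal (ω y v) • Measure.dirac (y + (v : Site d))) s
  simp only [Measure.coe_finsetSum, Finset.sum_apply, Measure.smul_apply, smul_eq_mul]
  refine Finset.measurable_sum _ fun v _ => Measurable.mul_const ?_ _
  refine ENNReal.measurable_ofReal.comp ?_
  exact (measurable_pi_apply v).comp (measurable_subtype_coe.comp (measurable_pi_apply y))

theorem measurable_partialTraj {d : ℕ} (x : Site d) (n : ℕ) :
    Measurable (fun ω : Env d =>
      Kernel.partialTraj (X := fun _ => Site d) (historyKernel ω) 0 n (fun _ => x)) := by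
  induction n with
  | zero => simp only [Kernel.partialTraj_self]; exact measurable_const
  | succ n ih =>
    refine Measure.measurable_of_measurable_coe _ fun s hs => ?_
    have key : ∀ ω : Env d,
        Kernel.partialTraj (X := fun _ => Site d) (historyKernel ω) 0 (n + 1) (fun _ => x) s =
        ∑' z, Kernel.partialTraj (X := fun _ => Site d) (historyKernel ω) n (n + 1) z s *
          Kernel.partialTraj (X := fun _ => Site d) (historyKernel ω) 0 n (fun _ => x) {z} := by
      intro ω
      rw [Kernel.partialTraj_succ_eq_comp (Nat.zero_le n), Kernel.comp_apply' _ _ _ hs,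
        lintegral_countable']
    simp only [key]
    refine Measurable.tsum fun z => Measurable.mul ?_
      ((Measure.measurable_coe (MeasurableSet.singleton z)).comp ih)
    simp only [Kernel.partialTraj_succ_self]
    have key2 : ∀ ω : Env d,
        ((Kernel.id ×ₖ ((historyKernel ω n).map
            (MeasurableEquiv.piSingleton (X := fun _ => Site d) n))).map
          (IicProdIoc (X := fun _ => Site d) n (n + 1))) z s =
        stepKernel ω (z ⟨n, Finset.mem_Iic.mpr le_rfl⟩)
          {y | IicProdIoc (X := fun _ => Site d) n (n + 1)
            (z, MeasurableEquiv.piSingleton (X := fun _ => Site d) n y) ∈ s} := by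
      intro ω
      have hm : Measurable (IicProdIoc (X := fun _ => Site d) n (n + 1)) :=
        measurable_IicProdIoc
      rw [Kernel.map_apply' _ hm _ hs, Kernel.prod_apply' _ _ _ (hm hs), Kernel.id_apply,
        lintegral_dirac, Kernel.map_apply' _ (MeasurableEquiv.measurable _) _ .of_discrete]
      rfl
    simp only [key2]
    exact (Measure.measurable_coe (.of_discrete)).comp (measurable_stepKernel _)

/-- The quenched law depends measurably on the environment. -/
theorem measurable_quenchedLaw {d : ℕ} (x : Site d) :
    Measurable (fun ω : Env d => quenchedLaw x ω) := by
  refine Measurable.measure_of_isPiSystem_of_isProbabilityMeasure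
    generateFrom_measurableCylinders.symm isPiSystem_measurableCylinders fun s hs => ?_
  obtain ⟨n, S, hS, rfl⟩ : ∃ (n : ℕ) (S : Set ((i : Finset.Iic n) → Site d)),
      MeasurableSet S ∧ s = cylinder (Finset.Iic n) S := by
    obtain ⟨t, S, hS, rfl⟩ := (mem_measurableCylinders s).mp hs
    have ht : t ⊆ Finset.Iic (t.sup id) := fun i hi =>
      Finset.mem_Iic.mpr (Finset.le_sup (f := id) hi)
    exact ⟨t.sup id, Finset.restrict₂ (π := fun _ => Site d) ht ⁻¹' S,
      Finset.measurable_restrict₂ ht hS, rfl⟩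
  have key : ∀ ω : Env d, quenchedLaw x ω (cylinder (Finset.Iic n) S) =
      Kernel.partialTraj (X := fun _ => Site d) (historyKernel ω) 0 n (fun _ => x) S := by
    intro ω
    rw [← Kernel.traj_map_frestrictLe_apply, Measure.map_apply (by fun_prop) hS]
    rfl
  simp only [key]
  exact (Measure.measurable_coe hS).comp (measurable_partialTraj x n)

/-- The quenched law started at `x`, as a kernel in the environment. -/
def quenchedKernel {d : ℕ} (x : Site d) : Kernel (Env d) (ℕ → Site d) where
  toFun := quenchedLaw x
  measurable' := measurable_quenchedLaw x

instance instIsMarkovKernelQuenchedKernel {d : ℕ} (x : Site d) :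
    IsMarkovKernel (quenchedKernel x) where
  isProbabilityMeasure ω := instIsProbabilityMeasureQuenchedLaw x ω

/-- The annealed law `ℙ^x` on pairs (environment, path):
`ℙ^x (F × G) = ∫_F P_ω^x (G) P(dω)`. -/
def annealedLaw {d : ℕ} (P : Measure (Env d)) (x : Site d) : Measure (Env d × (ℕ → Site d)) :=
  P ⊗ₘ quenchedKernel x

/-! ### Hypotheses on the environment -/

/-- The `l¹`-distance on `ℤ^d`. -/
def dist1 {d : ℕ} (x y : Site d) : ℕ := ∑ i, (x i - y i).natAbs

/-- The spatial shift `(θ^y ω)_x = ω_{x + y}`. -/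
def shift {d : ℕ} (y : Site d) (ω : Env d) : Env d := fun x => ω (x + y)

/-- Invariance of the environment measure under all spatial shifts. -/
def TranslationInvariant {d : ℕ} (P : Measure (Env d)) : Prop :=
  ∀ y : Site d, MeasurePreserving (shift y) P P

/-- Uniform ellipticity: for some `κ > 0`, almost surely `ω(x, e) > κ` for all sites `x` and all
steps `e` with `|e| = 1`. -/
def UniformlyElliptic {d : ℕ} (P : Measure (Env d)) : Prop :=
  ∃ κ : ℝ, 0 < κ ∧
    ∀ᵐ ω ∂P, ∀ (x : Site d) (e : steps d), ∑ i, (e : Site d) i ^ 2 = 1 → κ < ω x e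

/-- Configurations `η ∈ M^Λ` on a set of sites `Λ`. -/
abbrev Config {d : ℕ} (Λ : Set (Site d)) : Type := Λ → StepLaw d

/-- The configuration `(ω_x)_{x ∈ Λ}`. -/
def restrictTo {d : ℕ} (Λ : Set (Site d)) (ω : Env d) : Config Λ := fun x => ω x

/-- The `σ`-field `F_Λ = σ(ω_x : x ∈ Λ)`. -/
abbrev sigmaField {d : ℕ} (Λ : Set (Site d)) : MeasurableSpace (Env d) :=
  MeasurableSpace.comap (restrictTo Λ) MeasurableSpace.pi

/-- The `r`-boundary `∂_r V` of `V`: the points outside `V` at distance at most `r` from `V`. -/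
def rBoundary {d : ℕ} (r : ℕ) (V : Set (Site d)) : Set (Site d) :=
  {x | x ∉ V ∧ ∃ y ∈ V, dist1 x y ≤ r}

/-- `r`-Markov environments: for finite `V`, the conditional law of `(ω_x)_{x ∈ V}` given
`F_{V^c}` is almost surely its conditional law given `F_{∂_r V}`. -/
def IsRMarkov {d : ℕ} (r : ℕ) (P : Measure (Env d)) : Prop :=
  ∀ (V : Finset (Site d)) (B : Set (Config (V : Set (Site d)))), MeasurableSet B →
    P⟦restrictTo (V : Set (Site d)) ⁻¹' B | sigmaField ((V : Set (Site d))ᶜ)⟧ =ᵐ[P]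
      P⟦restrictTo (V : Set (Site d)) ⁻¹' B | sigmaField (rBoundary r (V : Set (Site d)))⟧

/-- `P((ω_x)_{x ∈ Δ} ∈ · | η)` for `η ∈ M^Λ`: the regular conditional distribution of
`(ω_x)_{x ∈ Δ}` given `(ω_x)_{x ∈ Λ} = η`. -/
def condLaw {d : ℕ} (P : Measure (Env d)) [IsFiniteMeasure P] (Δ : Finset (Site d))
    (Λ : Set (Site d)) : Kernel (Config Λ) (Config (Δ : Set (Site d))) :=
  condDistrib (restrictTo (Δ : Set (Site d))) (restrictTo Λ) P

/-- The mixing condition with range `r` and constants `γ`, `C`. The set `N` is a set of full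
measure of configurations `η ∈ M^{V^c}`. A bound `dμ/dν ≤ K` on the density, with a constant
`K < ∞`, is the inequality of measures `μ ≤ K • ν`. The sum over `A` is always summable as
`γ > 0` and `Δ` is finite. -/
def MixingBound {d : ℕ} (P : Measure (Env d)) [IsFiniteMeasure P] (r : ℕ) (γ C : ℝ) : Prop :=
  ∀ Δ V : Finset (Site d), Δ ⊆ V → (∀ x ∈ Δ, ∀ y ∉ V, r ≤ dist1 x y) →
    ∀ A : Set (Site d), A ⊆ (V : Set (Site d))ᶜ →
      ∃ N : Set (Config ((V : Set (Site d))ᶜ)),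
        (∀ᵐ η ∂(P.map (restrictTo ((V : Set (Site d))ᶜ))), η ∈ N) ∧
        ∀ η ∈ N, ∀ η' ∈ N, (∀ x : ((V : Set (Site d))ᶜ : Set (Site d)), (x : Site d) ∉ A → η x = η' x) →
          condLaw P Δ ((V : Set (Site d))ᶜ) η ≤
            ENNReal.ofReal
              (Real.exp (C * ∑' x : A, ∑ y ∈ Δ, Real.exp (-γ * (dist1 (x : Site d) y : ℝ)))) •
              condLaw P Δ ((V : Set (Site d))ᶜ) η'

/-- Condition (G): the environment is `r`-Markov for some `r ≥ 1` and satisfies the mixing bound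
with this `r` and some positive finite constants `γ`, `C`. -/
def ConditionG {d : ℕ} (P : Measure (Env d)) [IsFiniteMeasure P] : Prop :=
  ∃ r : ℕ, 1 ≤ r ∧ IsRMarkov r P ∧ ∃ γ C : ℝ, 0 < γ ∧ 0 < C ∧ MixingBound P r γ C

/-! ### Path functionals in the direction `e₁` (the coordinate `0`) -/

/-- The level `H_j(x) = {y : y · e₁ = x · e₁ + j}` relative to the site `x`. -/
def level {d : ℕ} [NeZero d] (x : Site d) (j : ℕ) : Set (Site d) := {y | y 0 = x 0 + j}

open Classical in
/-- The number of visits of the path to the level `H_j(X_0)` up to time `n`. -/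
def visits {d : ℕ} [NeZero d] (X : ℕ → Site d) (j n : ℕ) : ℕ :=
  ∑ i ∈ Finset.range (n + 1), if X i ∈ level (X 0) j then 1 else 0

/-- `D = inf {n ≥ 1 : X_n · e₁ ≤ X_0 · e₁}`, with `inf ∅ = ∞`. -/
def backtrackTime {d : ℕ} [NeZero d] (X : ℕ → Site d) : ℕ∞ :=
  ⨅ n ∈ {n : ℕ | 1 ≤ n ∧ X n 0 ≤ X 0 0}, (n : ℕ∞)

/-- `R`: the first time at which some level `H_j`, `j ≥ 0`, has been visited more than
`c (j + 1)²` times, or `D`, whichever comes first (`∞` if neither happens). -/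
def timeR {d : ℕ} [NeZero d] (c : ℝ) (X : ℕ → Site d) : ℕ∞ :=
  (⨅ n ∈ {n : ℕ | ∃ j : ℕ, c * ((j : ℝ) + 1) ^ 2 < (visits X j n : ℝ)}, (n : ℕ∞)) ⊓
    backtrackTime X

/-- `limsup_n (X_n · e₁) / n`, in the extended reals. -/
def upperSpeed {d : ℕ} [NeZero d] (X : ℕ → Site d) : EReal :=
  limsup (fun n : ℕ => (((X n 0 : ℝ) / (n : ℝ) : ℝ) : EReal)) atTop

end

end RWRE

/-! The argument is by contradiction. Suppose `timeR c` is almost surely finite for every `c > 0`.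
Call the stretch of the path from the first hit of a level `m` to the first hit of `m + L` good if
it never falls to `m - h` and makes at most `c (|j| + 1)²` visits to each level `m + j`. It is shown
that good stretches must be rare, whereas a path of positive upper speed must have many.

Rarity. A path that is good for arbitrarily large `L` is transient, and after its last visit to a
suitable level it lies in `neverR c'` for some `c'` (`exists_after_mem_neverR`). By assumption and
translation invariance this has probability zero from every site, so goodness up to `L` becomes
unlikely as `L` grows. To make this uniform in the past, start at a record level `m`: the past has
only used the environment below `m`. The good stretch makes a bounded number of visits below `m +
r`, where simple random walk replaces the environment at the cost of a constant factor
(`weight_le_modify`). Above `m + r` mixing applies, and its constant does not depend on `L`, because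
quadratically many visits per level are summable against exponential decay (`sum_exp_le`). Hence
`exists_good_unlikely`: for given `h`, `c` and `ε`, some large `L` makes each good stretch at most
`ε`-likely given the past at the record. Separated stretches then cost a product of factors `ε`, and
a union bound excludes a quarter of the first `n` levels being good for infinitely many `n`
(`ae_eventually_card_le`).

Abundance. Suppose level `n` is hit within time `A n`. Take `8 A` scales `(h i, L i)` with `L i ≥ h
i` and `h (i + 1) ≥ 2 L i`. The backtracking during one passage from a level to the next spoils,
over all scales together, at most twice as many starting levels as the passage lasts
(`sum_scales_le`). So on some scale backtracking spoils at most a quarter of the levels, crowding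
spoils at most another quarter (`card_crowded_le`), the top `L i` levels are fewer than a quarter,
and more than a quarter are good (`exists_many_good`). Positive upper speed supplies infinitely many
such `n` for some `A`, a contradiction. -/

namespace RWRE

/-! ### Finite paths and cylinders -/

/-- The paths that agree with `γ` up to time `n`. -/
def cyl {d : ℕ} (n : ℕ) (γ : ℕ → Site d) : Set (ℕ → Site d) := {X | ∀ i ≤ n, X i = γ i}

/-- Events that depend on the path up to time `n` only. -/
def DeterminedBy {d : ℕ} (n : ℕ) (A : Set (ℕ → Site d)) : Prop :=
  ∀ X Y : ℕ → Site d, (∀ i ≤ n, X i = Y i) → X ∈ A → Y ∈ A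

/-- A finite path, stopped at its last site. -/
def extend {d : ℕ} (n : ℕ) (γ : Fin (n + 1) → Site d) : ℕ → Site d :=
  fun i => γ ⟨min i n, by omega⟩

/-- The path after time `n`. -/
def after {d : ℕ} (n : ℕ) (X : ℕ → Site d) : ℕ → Site d := fun i => X (n + i)

/-- The quenched probability of following `γ` up to time `n`. -/
noncomputable def weight {d : ℕ} (ω : Env d) (n : ℕ) (γ : ℕ → Site d) : ℝ≥0∞ :=
  ∏ i ∈ Finset.range n, stepKernel ω (γ i) {γ (i + 1)}

section
variable {d : ℕ}

theorem measurable_after (n : ℕ) : Measurable (after (d := d) n) :=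
  measurable_pi_lambda _ fun i => measurable_pi_apply (n + i)

theorem determinedBy_cyl (n : ℕ) (γ : ℕ → Site d) : DeterminedBy n (cyl n γ) :=
  fun _ _ h hX i hi => (h i hi).symm.trans (hX i hi)

theorem DeterminedBy.mono {n m : ℕ} {A : Set (ℕ → Site d)} (h : DeterminedBy n A) (hnm : n ≤ m) :
    DeterminedBy m A :=
  fun X Y hXY => h X Y fun i hi => hXY i (hi.trans hnm)

theorem DeterminedBy.inter {n : ℕ} {A B : Set (ℕ → Site d)} (hA : DeterminedBy n A)
    (hB : DeterminedBy n B) : DeterminedBy n (A ∩ B) :=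
  fun X Y h hX => ⟨hA X Y h hX.1, hB X Y h hX.2⟩

theorem DeterminedBy.eq_preimage {n : ℕ} {A : Set (ℕ → Site d)} (h : DeterminedBy n A) :
    A = (fun (X : ℕ → Site d) (i : Fin (n + 1)) => X i) ⁻¹' {γ | extend n γ ∈ A} := by
  ext X
  have hX : ∀ i ≤ n, X i = extend n (fun i : Fin (n + 1) => X i) i := by
    intro i hi
    simp [extend, hi]
  exact ⟨fun hA => h _ _ hX hA, fun hA => h _ _ (fun i hi => (hX i hi).symm) hA⟩

theorem DeterminedBy.measurableSet {n : ℕ} {A : Set (ℕ → Site d)} (h : DeterminedBy n A) :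
    MeasurableSet A := by
  rw [h.eq_preimage]
  exact (measurable_pi_lambda _ fun i => measurable_pi_apply _) (MeasurableSet.of_discrete)

theorem DeterminedBy.measure_eq_tsum {n : ℕ} {A : Set (ℕ → Site d)} (h : DeterminedBy n A)
    (μ : Measure (ℕ → Site d)) :
    μ A = ∑' γ : {γ : Fin (n + 1) → Site d | extend n γ ∈ A}, μ (cyl n (extend n γ)) := by
  conv_lhs => rw [h.eq_preimage]
  have hm : Measurable (fun (X : ℕ → Site d) (i : Fin (n + 1)) => X i) :=
    measurable_pi_lambda _ fun i => measurable_pi_apply _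
  rw [← tsum_measure_preimage_singleton (Set.to_countable _)
    (fun y _ => hm (MeasurableSet.singleton y))]
  refine tsum_congr fun γ => congrArg μ ?_
  ext X
  simp only [Set.mem_preimage, Set.mem_singleton_iff, cyl, Set.mem_ofPred_eq, funext_iff, extend]
  constructor
  · intro hX i hi
    have := hX ⟨i, by omega⟩
    simpa [hi] using this
  · intro hX i
    have := hX i (by omega)
    simpa [Nat.lt_succ_iff.mp i.2] using this

theorem measurableSet_cyl (n : ℕ) (γ : ℕ → Site d) : MeasurableSet (cyl n γ) :=
  (determinedBy_cyl n γ).measurableSet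

theorem measure_eq_of_cyl {n : ℕ} {A : Set (ℕ → Site d)} (h : DeterminedBy n A)
    {μ ν : Measure (ℕ → Site d)} (hμν : ∀ γ ∈ A, μ (cyl n γ) = ν (cyl n γ)) : μ A = ν A := by
  rw [h.measure_eq_tsum, h.measure_eq_tsum]
  exact tsum_congr fun γ => hμν _ γ.2

/-- Finite measures on paths are determined by their values on cylinders. -/
theorem ext_of_cyl {μ ν : Measure (ℕ → Site d)} [IsFiniteMeasure μ]
    (h : ∀ n γ, μ (cyl n γ) = ν (cyl n γ)) : μ = ν := by
  have hdet : ∀ n (A : Set (ℕ → Site d)), DeterminedBy n A → μ A = ν A :=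
    fun n A hA => measure_eq_of_cyl hA fun γ _ => h n γ
  refine ext_of_generate_finite (measurableCylinders fun _ : ℕ => Site d)
    generateFrom_measurableCylinders.symm isPiSystem_measurableCylinders ?_ ?_
  · intro s hs
    obtain ⟨t, S, -, rfl⟩ := (mem_measurableCylinders s).mp hs
    refine hdet (t.sup id) _ fun X Y hXY hX => ?_
    rw [mem_cylinder] at hX ⊢
    convert hX using 1
    ext1 i
    exact (hXY i (Finset.le_sup (f := id) i.2)).symm
  · exact hdet 0 _ fun _ _ _ _ => trivial

/-! ### Quenched laws of cylinders -/

/-- The link between the Ionescu-Tulcea construction and path weights: later computations with the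
quenched law go through this product formula. -/
theorem quenchedLaw_cyl (x : Site d) (ω : Env d) (n : ℕ) (γ : ℕ → Site d) :
    quenchedLaw x ω (cyl n γ) = if γ 0 = x then weight ω n γ else 0 := by
  have key : ∀ n, quenchedLaw x ω (cyl n γ) =
      Kernel.partialTraj (X := fun _ => Site d) (historyKernel ω) 0 n (fun _ => x)
        {fun i : Finset.Iic n => γ i} := by
    intro n
    rw [← Kernel.traj_map_frestrictLe_apply, Measure.map_apply (by fun_prop) (by measurability)]
    refine congrArg _ ?_
    ext X
    simp only [cyl, Set.mem_ofPred_eq, Set.mem_preimage, Set.mem_singleton_iff, funext_iff,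
      Subtype.forall, Finset.mem_Iic]
    rfl
  rw [key]
  clear key
  induction n with
  | zero =>
    rw [Kernel.partialTraj_self, Kernel.id_apply, Measure.dirac_apply' _ (by measurability)]
    by_cases h : γ 0 = x
    · rw [if_pos h, Set.indicator_of_mem]
      · simp [weight]
      · ext1 i
        have : (i : ℕ) = 0 := Nat.le_zero.mp (Finset.mem_Iic.mp i.2)
        simp [this, h]
    · rw [if_neg h, Set.indicator_of_notMem]
      intro h'
      exact h (congrFun h' ⟨0, by simp⟩).symm
  | succ n ih =>
    rw [Kernel.partialTraj_succ_eq_comp (Nat.zero_le n),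
      Kernel.comp_apply' _ _ _ (by measurability), lintegral_countable']
    have key2 : ∀ z : (i : Finset.Iic n) → Site d,
        Kernel.partialTraj (X := fun _ => Site d) (historyKernel ω) n (n + 1) z
          {fun i : Finset.Iic (n + 1) => γ i} =
            if z = (fun i : Finset.Iic n => γ i) then stepKernel ω (γ n) {γ (n + 1)} else 0 := by
      intro z
      have hm : Measurable (IicProdIoc (X := fun _ => Site d) n (n + 1)) :=
        measurable_IicProdIoc
      rw [Kernel.partialTraj_succ_self, Kernel.map_apply' _ hm _ (by measurability),
        Kernel.prod_apply' _ _ _ (hm (by measurability)), Kernel.id_apply,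
        lintegral_dirac, Kernel.map_apply' _ (MeasurableEquiv.measurable _) _ .of_discrete]
      change stepKernel ω (z ⟨n, _⟩) {y | IicProdIoc (X := fun _ => Site d) n (n + 1)
            (z, MeasurableEquiv.piSingleton (X := fun _ => Site d) n y) ∈
              ({fun i : Finset.Iic (n + 1) => γ i} : Set ((i : Finset.Iic (n + 1)) → Site d))} = _
      have hmem : ∀ y, IicProdIoc (X := fun _ => Site d) n (n + 1)
            (z, MeasurableEquiv.piSingleton (X := fun _ => Site d) n y) ∈
              ({fun i : Finset.Iic (n + 1) => γ i} : Set ((i : Finset.Iic (n + 1)) → Site d)) ↔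
              z = (fun i : Finset.Iic n => γ i) ∧ y = γ (n + 1) := by
        intro y
        simp only [Set.mem_singleton_iff, funext_iff, Subtype.forall, Finset.mem_Iic, IicProdIoc]
        constructor
        · intro h
          refine ⟨fun a ha => ?_, ?_⟩
          · have := h a (by omega)
            rwa [dif_pos ha] at this
          · have := h (n + 1) le_rfl
            rw [dif_neg (by omega)] at this
            exact this
        · rintro ⟨h1, h2⟩ a ha
          by_cases h : a ≤ n
          · rw [dif_pos h]; exact h1 a h
          · rw [dif_neg h]
            obtain rfl : a = n + 1 := by omega
            exact h2
      simp only [hmem]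
      split_ifs with h
      · subst h
        simp
      · simp [h]
    simp only [key2]
    rw [tsum_eq_single (fun i : Finset.Iic n => γ i), if_pos rfl, ih]
    · simp only [weight, Finset.prod_range_succ]
      split_ifs
      · rw [mul_comm]
      · simp
    · intro z hz
      simp [hz]

/-- The environment at the final site is never read, hence the strict `i < n`. A path ending at a
record level therefore depends only on the environment strictly below that level. -/
theorem weight_congr {ω ω' : Env d} {n : ℕ} {γ γ' : ℕ → Site d} (hγ : ∀ i ≤ n, γ i = γ' i)
    (hω : ∀ i < n, ω (γ i) = ω' (γ i)) : weight ω n γ = weight ω' n γ' := by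
  refine Finset.prod_congr rfl fun i hi => ?_
  have hi := Finset.mem_range.mp hi
  rw [← hγ i hi.le, ← hγ (i + 1) hi]
  change (∑ v : steps d, ENNReal.ofReal (ω (γ i) v) • Measure.dirac (γ i + (v : Site d))) _ =
    (∑ v : steps d, ENNReal.ofReal (ω' (γ i) v) • Measure.dirac (γ i + (v : Site d))) _
  rw [hω i hi]

theorem measurable_weight (n : ℕ) (γ : ℕ → Site d) : Measurable fun ω : Env d => weight ω n γ :=
  Finset.measurable_prod _ fun _ _ =>
    (Measure.measurable_coe (MeasurableSet.singleton _)).comp (measurable_stepKernel _)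

/-- The concatenation of `γ` up to time `n` with `γ'`. -/
def concat (n : ℕ) (γ γ' : ℕ → Site d) : ℕ → Site d :=
  fun i => if i < n then γ i else γ' (i - n)

theorem cyl_inter_after (n k : ℕ) (γ γ' : ℕ → Site d) (h : γ' 0 = γ n) :
    cyl n γ ∩ after n ⁻¹' cyl k γ' = cyl (n + k) (concat n γ γ') := by
  ext X
  simp only [cyl, after, concat, Set.mem_inter_iff, Set.mem_ofPred_eq, Set.mem_preimage]
  constructor
  · rintro ⟨h1, h2⟩ i hi
    split_ifs with hin
    · exact h1 i hin.le
    · have := h2 (i - n) (by omega)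
      rwa [Nat.add_sub_cancel' (by omega)] at this
  · intro hX
    refine ⟨fun i hi => ?_, fun i hi => ?_⟩
    · rw [hX i (by omega)]
      split_ifs with hin
      · rfl
      · obtain rfl : i = n := by omega
        simpa using h
    · rw [hX (n + i) (by omega), if_neg (by omega)]
      congr 1; omega

theorem weight_concat (ω : Env d) (n k : ℕ) (γ γ' : ℕ → Site d) (h : γ' 0 = γ n) :
    weight ω (n + k) (concat n γ γ') = weight ω n γ * weight ω k γ' := by
  rw [weight, Finset.prod_range_add]
  congr 1
  · refine Finset.prod_congr rfl fun i hi => ?_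
    have hi := Finset.mem_range.mp hi
    simp only [concat, if_pos hi]
    split_ifs with h1
    · rfl
    · obtain rfl : i + 1 = n := by omega
      simp [h]
  · refine Finset.prod_congr rfl fun i hi => ?_
    simp only [concat]
    rw [if_neg (by omega), if_neg (by omega)]
    congr 3 <;> omega

/-- The Markov property at a fixed time. -/
theorem quenchedLaw_cyl_inter (x : Site d) (ω : Env d) (n : ℕ) (γ : ℕ → Site d)
    {B : Set (ℕ → Site d)} (hB : MeasurableSet B) :
    quenchedLaw x ω (cyl n γ ∩ after n ⁻¹' B) =
      quenchedLaw x ω (cyl n γ) * quenchedLaw (γ n) ω B := by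
  have hm := measurable_after (d := d) n
  have key : ((quenchedLaw x ω).restrict (cyl n γ)).map (after n) =
      (quenchedLaw x ω (cyl n γ)) • quenchedLaw (γ n) ω := by
    refine ext_of_cyl fun k γ' => ?_
    rw [Measure.map_apply hm (measurableSet_cyl _ _),
      Measure.restrict_apply (hm (measurableSet_cyl _ _)), Set.inter_comm, Measure.smul_apply,
      smul_eq_mul, quenchedLaw_cyl (γ n)]
    split_ifs with h
    · rw [cyl_inter_after n k γ γ' h, quenchedLaw_cyl, quenchedLaw_cyl, weight_concat ω n k γ γ' h]
      have : concat n γ γ' 0 = γ 0 := by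
        simp only [concat]
        split_ifs with h0
        · rfl
        · obtain rfl : n = 0 := by omega
          exact h
      rw [this]
      split_ifs <;> simp
    · rw [mul_zero]
      convert measure_empty (μ := quenchedLaw x ω)
      refine Set.eq_empty_of_forall_notMem fun X hX => h ?_
      exact (hX.2 0 (Nat.zero_le _)).symm.trans (hX.1 n le_rfl)
  have := congrArg (fun μ => μ B) key
  simpa [Measure.map_apply hm hB, Measure.restrict_apply (hm hB), Set.inter_comm] using this

/-- If `B` is null from every site, then it is null for the path after time `n`. -/
theorem quenchedLaw_after_eq_zero (x : Site d) (ω : Env d) (n : ℕ) {B : Set (ℕ → Site d)}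
    (hB : MeasurableSet B) (h : ∀ z, quenchedLaw z ω B = 0) :
    quenchedLaw x ω (after n ⁻¹' B) = 0 := by
  refine measure_mono_null (t := ⋃ γ : Fin (n + 1) → Site d,
    (cyl n (extend n γ) ∩ after n ⁻¹' B)) (fun X hX => ?_) ?_
  · refine Set.mem_iUnion.mpr ⟨fun i => X i, fun i hi => ?_, hX⟩
    simp [extend, hi]
  · refine measure_iUnion_null fun γ => ?_
    rw [quenchedLaw_cyl_inter _ _ _ _ hB, h, mul_zero]

/-- The paths that stay in `U`. -/
def staysIn (U : Set (Site d)) : Set (ℕ → Site d) := {X | ∀ i, X i ∈ U}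

theorem measurableSet_staysIn (U : Set (Site d)) : MeasurableSet (staysIn U) := by
  have : staysIn U = ⋂ i, (fun X : ℕ → Site d => X i) ⁻¹' U := by
    ext X; simp [staysIn]
  rw [this]
  exact MeasurableSet.iInter fun i => measurable_pi_apply i (.of_discrete)

/-- As long as it stays in `U`, the walk only depends on the environment in `U`. -/
theorem quenchedLaw_inter_staysIn {U : Set (Site d)} {ω ω' : Env d} (h : ∀ x ∈ U, ω x = ω' x)
    (x : Site d) {B : Set (ℕ → Site d)} (hB : MeasurableSet B) :
    quenchedLaw x ω (B ∩ staysIn U) = quenchedLaw x ω' (B ∩ staysIn U) := by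
  have key : (quenchedLaw x ω).restrict (staysIn U) = (quenchedLaw x ω').restrict (staysIn U) := by
    refine ext_of_cyl fun n γ => ?_
    rw [Measure.restrict_apply (measurableSet_cyl _ _),
      Measure.restrict_apply (measurableSet_cyl _ _)]
    -- Staying in `U` forever is the decreasing limit of staying in `U` up to time `N`, an event to
    -- which the product formula for cylinders applies.
    set A : ℕ → Set (ℕ → Site d) := fun N => cyl n γ ∩ {X | ∀ i ≤ N, X i ∈ U} with hA
    have hdet : ∀ N, DeterminedBy (max n N) (A N) := fun N =>
      ((determinedBy_cyl n γ).mono (le_max_left _ _)).inter fun X Y hXY hX i hi => by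
        rw [← hXY i (hi.trans (le_max_right _ _))]; exact hX i hi
    have hanti : Antitone A := fun _ _ hNM _ hX => ⟨hX.1, fun i hi => hX.2 i (hi.trans hNM)⟩
    have hint : cyl n γ ∩ staysIn U = ⋂ N, A N := by
      ext X
      simp only [hA, staysIn, Set.mem_inter_iff, Set.mem_ofPred_eq, Set.mem_iInter]
      exact ⟨fun h N => ⟨h.1, fun i _ => h.2 i⟩, fun h => ⟨(h 0).1, fun i => (h i).2 i le_rfl⟩⟩
    have hlim : ∀ ω : Env d, Tendsto (fun N => quenchedLaw x ω (A N)) atTop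
        (nhds (quenchedLaw x ω (cyl n γ ∩ staysIn U))) := fun ω => by
      rw [hint]
      exact tendsto_measure_iInter_atTop
        (fun N => (hdet N).measurableSet.nullMeasurableSet) hanti ⟨0, measure_ne_top _ _⟩
    refine tendsto_nhds_unique_of_eventuallyEq (hlim ω) (hlim ω') ?_
    filter_upwards [eventually_ge_atTop n] with N hN
    refine measure_eq_of_cyl (hdet N) fun γ' hγ' => ?_
    rw [quenchedLaw_cyl, quenchedLaw_cyl]
    rw [weight_congr (fun _ _ => rfl) fun i hi => h _ (hγ'.2 i ?_)]
    omega
  have := congrArg (fun μ => μ B) key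
  simpa [Measure.restrict_apply hB] using this

theorem stepKernel_shift (ω : Env d) (x y z : Site d) :
    stepKernel (shift x ω) y {z} = stepKernel ω (y + x) {z + x} := by
  change (∑ v : steps d, ENNReal.ofReal (ω (y + x) v) • Measure.dirac (y + (v : Site d))) _ =
    (∑ v : steps d, ENNReal.ofReal (ω (y + x) v) • Measure.dirac (y + x + (v : Site d))) _
  simp only [Measure.coe_finsetSum, Finset.sum_apply, Measure.smul_apply, smul_eq_mul]
  refine Finset.sum_congr rfl fun v _ => ?_
  rw [Measure.dirac_apply' _ (.of_discrete), Measure.dirac_apply' _ (.of_discrete)]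
  have : y + (v : Site d) ∈ ({z} : Set (Site d)) ↔ y + x + (v : Site d) ∈ ({z + x} : Set _) := by
    simp only [Set.mem_singleton_iff]
    rw [add_right_comm, add_left_inj]
  by_cases h : y + (v : Site d) ∈ ({z} : Set (Site d))
  · rw [Set.indicator_of_mem h, Set.indicator_of_mem (this.mp h)]; rfl
  · rw [Set.indicator_of_notMem h, Set.indicator_of_notMem (this.not.mp h)]

theorem measurable_add_const (z : Site d) : Measurable fun (X : ℕ → Site d) n => X n + z :=
  measurable_pi_lambda _ fun n => (Measurable.of_discrete (f := fun y => y + z)).comp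
    (measurable_pi_apply n)

/-- Translating the starting point amounts to shifting the environment. -/
theorem quenchedLaw_eq_map (x : Site d) (ω : Env d) :
    quenchedLaw x ω = (quenchedLaw 0 (shift x ω)).map fun X n => X n + x := by
  have hm := measurable_add_const x
  refine ext_of_cyl fun n γ => ?_
  have : (fun (X : ℕ → Site d) n => X n + x) ⁻¹' cyl n γ = cyl n fun i => γ i - x := by
    ext X; simp [cyl, eq_sub_iff_add_eq]
  rw [Measure.map_apply hm (measurableSet_cyl _ _), this, quenchedLaw_cyl, quenchedLaw_cyl]
  simp only [sub_eq_zero]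
  congr 1
  refine Finset.prod_congr rfl fun _ _ => ?_
  rw [stepKernel_shift]
  simp

end

section
variable {d : ℕ}

/-! ### Exponential sums on the lattice -/

theorem dist1_sub (x y z : Site d) : dist1 (x - z) (y - z) = dist1 x y := by
  simp [dist1]

theorem summable_exp_natAbs {a : ℝ} (ha : 0 < a) :
    Summable fun k : ℤ => Real.exp (-a * (k.natAbs : ℝ)) := by
  have h : Summable fun n : ℕ => Real.exp (-a * (n : ℝ)) := by
    have := summable_geometric_of_lt_one (Real.exp_pos (-a)).le (Real.exp_lt_one_iff.mpr (by linarith))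
    refine this.congr fun n => ?_
    rw [← Real.exp_nat_mul, mul_comm]
  refine Summable.of_nat_of_neg ?_ ?_ <;> simpa using h

/-- A finite set of sites sits in a box, over which the exponential of the `l¹`-norm factorises into
one-dimensional geometric sums. -/
theorem summable_exp_dist1 {a : ℝ} (ha : 0 < a) :
    Summable fun x : Site d => Real.exp (-a * (dist1 x 0 : ℝ)) := by
  have hprod : ∀ x : Site d, Real.exp (-a * (dist1 x 0 : ℝ)) =
      ∏ i, Real.exp (-a * ((x i).natAbs : ℝ)) := by
    intro x
    rw [← Real.exp_sum, ← Finset.mul_sum]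
    simp [dist1]
  refine summable_of_sum_le (c := ∏ _i : Fin d, ∑' k : ℤ, Real.exp (-a * (k.natAbs : ℝ)))
    (fun _ => (Real.exp_pos _).le) fun s => ?_
  calc ∑ x ∈ s, Real.exp (-a * (dist1 x 0 : ℝ))
      ≤ ∑ x ∈ Fintype.piFinset fun i => s.image fun x : Site d => x i,
          ∏ i, Real.exp (-a * ((x i).natAbs : ℝ)) := by
        simp only [hprod]
        refine Finset.sum_le_sum_of_subset_of_nonneg (fun x hx => ?_) fun _ _ _ => by positivity
        exact Fintype.mem_piFinset.mpr fun i => Finset.mem_image_of_mem (fun x : Site d => x i) hx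
    _ = ∏ i, ∑ k ∈ s.image fun x => x i, Real.exp (-a * (k.natAbs : ℝ)) :=
        (Finset.prod_univ_sum (fun i : Fin d => s.image fun x : Site d => x i)
          fun _ k => Real.exp (-a * ((k : ℤ).natAbs : ℝ))).symm
    _ ≤ _ := Finset.prod_le_prod (fun _ _ => Finset.sum_nonneg fun _ _ => (Real.exp_pos _).le)
        fun _ _ => (summable_exp_natAbs ha).sum_le_tsum _ fun _ _ => (Real.exp_pos _).le

theorem summable_exp_dist1_right {a : ℝ} (ha : 0 < a) (y : Site d) :
    Summable fun x : Site d => Real.exp (-a * (dist1 x y : ℝ)) := by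
  have := (Equiv.subRight y).summable_iff.mpr (summable_exp_dist1 (d := d) ha)
  refine this.congr fun x => ?_
  rw [Function.comp_apply, Equiv.subRight_apply, ← dist1_sub x y y, sub_self]

/-- Half of the exponent is spent on decay in `ρ`; the other half is summed over the whole lattice,
which gives a constant independent of `y` and `A`. -/
theorem tsum_exp_dist1_le {a : ℝ} (ha : 0 < a) (y : Site d) (A : Set (Site d)) (ρ : ℝ)
    (hA : ∀ x ∈ A, ρ ≤ dist1 x y) :
    ∑' x : A, Real.exp (-a * (dist1 (x : Site d) y : ℝ)) ≤
      (∑' x : Site d, Real.exp (-(a / 2) * (dist1 x 0 : ℝ))) * Real.exp (-(a / 2) * ρ) := by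
  have ha2 : 0 < a / 2 := half_pos ha
  have hs := summable_exp_dist1_right ha2 y
  have heq : ∑' x : Site d, Real.exp (-(a / 2) * (dist1 x 0 : ℝ)) =
      ∑' x : Site d, Real.exp (-(a / 2) * (dist1 x y : ℝ)) := by
    rw [← (Equiv.subRight y).tsum_eq]
    refine tsum_congr fun x => ?_
    rw [Equiv.subRight_apply, ← dist1_sub x y y, sub_self]
  calc ∑' x : A, Real.exp (-a * (dist1 (x : Site d) y : ℝ))
      ≤ ∑' x : A, Real.exp (-(a / 2) * (dist1 (x : Site d) y : ℝ)) * Real.exp (-(a / 2) * ρ) := by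
        refine Summable.tsum_le_tsum (fun x => ?_) ((summable_exp_dist1_right ha y).subtype A)
          ((hs.subtype A).mul_right _)
        rw [← Real.exp_add, Real.exp_le_exp]
        nlinarith [hA x x.2]
    _ = (∑' x : A, Real.exp (-(a / 2) * (dist1 (x : Site d) y : ℝ))) *
          Real.exp (-(a / 2) * ρ) := tsum_mul_right
    _ ≤ _ := by
        rw [heq]
        refine mul_le_mul_of_nonneg_right ?_ (Real.exp_pos _).le
        exact hs.tsum_subtype_le (fun x => Real.exp (-(a / 2) * (dist1 x y : ℝ))) A
          fun _ => (Real.exp_pos _).le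

theorem finite_dist1_le (y : Site d) (n : ℕ) : {x : Site d | dist1 x y ≤ n}.Finite := by
  refine (Set.finite_Icc (fun i => y i - n) (fun i => y i + n)).subset fun x hx => ?_
  have h : ∀ i, (x i - y i).natAbs ≤ n := fun i =>
    le_trans (Finset.single_le_sum (f := fun i => (x i - y i).natAbs) (fun _ _ => Nat.zero_le _)
      (Finset.mem_univ i)) hx
  exact ⟨fun i => by have := h i; simp only; omega, fun i => by have := h i; simp only; omega⟩

theorem sub_le_dist1 (x y : Site d) (i : Fin d) : y i - x i ≤ dist1 x y := by
  have : (x i - y i).natAbs ≤ dist1 x y :=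
    Finset.single_le_sum (f := fun i => (x i - y i).natAbs) (fun _ _ => Nat.zero_le _)
      (Finset.mem_univ i)
  omega

/-! ### Decoupling -/

/-- Extension of a configuration by an arbitrary value. -/
noncomputable def extendConfig (Λ : Set (Site d)) (η : Config Λ) : Env d :=
  open Classical in fun x => if h : x ∈ Λ then η ⟨x, h⟩ else Classical.arbitrary _

theorem measurable_extendConfig (Λ : Set (Site d)) : Measurable (extendConfig Λ) := by
  refine measurable_pi_lambda _ fun x => ?_
  by_cases h : x ∈ Λ
  · simpa only [extendConfig, dif_pos h] using measurable_pi_apply _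
  · simpa only [extendConfig, dif_neg h] using measurable_const

theorem measurable_restrictTo (Λ : Set (Site d)) : Measurable (restrictTo Λ) :=
  measurable_pi_lambda _ fun _ => measurable_pi_apply _

theorem comp_extendConfig {α : Type*} {Λ : Set (Site d)} {f : Env d → α}
    (hf : ∀ ω ω' : Env d, (∀ x ∈ Λ, ω x = ω' x) → f ω = f ω') (ω : Env d) :
    f (extendConfig Λ (restrictTo Λ ω)) = f ω :=
  hf _ _ fun x hx => by simp [extendConfig, hx, restrictTo]

/-- Averaging the pairwise comparison over `η'` bounds each conditional law by `K` times the
unconditional law on `Δ`. Integrating `f` against this bound decouples `f` from `g`. -/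
theorem lintegral_mul_le_of_condLaw_le {P : Measure (Env d)} [IsProbabilityMeasure P]
    {Δ : Finset (Site d)} {Λ : Set (Site d)} {K : ℝ≥0∞} {N : Set (Config Λ)}
    (hN : ∀ᵐ η ∂(P.map (restrictTo Λ)), η ∈ N)
    (hK : ∀ η ∈ N, ∀ η' ∈ N, condLaw P Δ Λ η ≤ K • condLaw P Δ Λ η')
    {f g : Env d → ℝ≥0∞} (hf : Measurable f) (hg : Measurable g)
    (hfΛ : ∀ ω ω' : Env d, (∀ x ∈ Λ, ω x = ω' x) → f ω = f ω')
    (hgΔ : ∀ ω ω' : Env d, (∀ x ∈ (Δ : Set (Site d)), ω x = ω' x) → g ω = g ω') :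
    ∫⁻ ω, f ω * g ω ∂P ≤ K * (∫⁻ ω, f ω ∂P) * ∫⁻ ω, g ω ∂P := by
  set f' : Config Λ → ℝ≥0∞ := fun η => f (extendConfig Λ η)
  set g' : Config (Δ : Set (Site d)) → ℝ≥0∞ := fun η => g (extendConfig _ η)
  have hf' : Measurable f' := hf.comp (measurable_extendConfig _)
  have hg' : Measurable g' := hg.comp (measurable_extendConfig _)
  have hmΛ := measurable_restrictTo Λ
  have hmΔ := measurable_restrictTo (Δ : Set (Site d))
  have hff : ∀ ω, f ω = f' (restrictTo Λ ω) := fun ω => (comp_extendConfig hfΛ ω).symm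
  have hgg : ∀ ω, g ω = g' (restrictTo _ ω) := fun ω => (comp_extendConfig hgΔ ω).symm
  have : IsProbabilityMeasure (P.map (restrictTo Λ)) :=
    Measure.isProbabilityMeasure_map hmΛ.aemeasurable
  have hint : ∀ (F : Config Λ → ℝ≥0∞), Measurable F →
      ∫⁻ ω, F (restrictTo Λ ω) * g' (restrictTo _ ω) ∂P =
        ∫⁻ η, F η * ∫⁻ ξ, g' ξ ∂(condLaw P Δ Λ η) ∂(P.map (restrictTo Λ)) := by
    intro F hF
    have hm : Measurable fun p : Config Λ × Config (Δ : Set (Site d)) => F p.1 * g' p.2 :=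
      (hF.comp measurable_fst).mul (hg'.comp measurable_snd)
    rw [← lintegral_map hm (hmΛ.prodMk hmΔ),
      ← compProd_map_condDistrib (X := restrictTo Λ) hmΔ.aemeasurable, Measure.lintegral_compProd hm]
    refine lintegral_congr fun η => ?_
    simp only
    exact lintegral_const_mul (F η) hg'
  have hbound : ∀ η ∈ N, ∫⁻ ξ, g' ξ ∂(condLaw P Δ Λ η) ≤ K * ∫⁻ ω, g ω ∂P := by
    intro η hη
    calc ∫⁻ ξ, g' ξ ∂(condLaw P Δ Λ η)
        = ∫⁻ _η', ∫⁻ ξ, g' ξ ∂(condLaw P Δ Λ η) ∂(P.map (restrictTo Λ)) := by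
          rw [lintegral_const, measure_univ, mul_one]
      _ ≤ ∫⁻ η', K * ∫⁻ ξ, g' ξ ∂(condLaw P Δ Λ η') ∂(P.map (restrictTo Λ)) := by
          refine lintegral_mono_ae ?_
          filter_upwards [hN] with η' hη'
          refine (lintegral_mono' (hK η hη η' hη') le_rfl).trans ?_
          rw [lintegral_smul_measure, smul_eq_mul]
      _ = K * ∫⁻ ω, g ω ∂P := by
          rw [lintegral_const_mul]
          · have := hint (fun _ => 1) measurable_const
            simp only [one_mul] at this
            rw [← this]
            simp only [hgg]
          · exact hg'.lintegral_kernel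
  calc ∫⁻ ω, f ω * g ω ∂P
      = ∫⁻ η, f' η * ∫⁻ ξ, g' ξ ∂(condLaw P Δ Λ η) ∂(P.map (restrictTo Λ)) := by
        rw [← hint f' hf']
        simp only [hff, hgg]
    _ ≤ ∫⁻ η, f' η * (K * ∫⁻ ω, g ω ∂P) ∂(P.map (restrictTo Λ)) := by
        refine lintegral_mono_ae ?_
        filter_upwards [hN] with η hη
        gcongr
        exact hbound η hη
    _ = K * (∫⁻ ω, f ω ∂P) * ∫⁻ ω, g ω ∂P := by
        rw [lintegral_mul_const _ hf', lintegral_map hf' hmΛ]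
        simp only [← hff]
        ring

/-- Decoupling of the environment below level `m` from the environment on a finite set above
level `m + r`; the constant is controlled by the number of sites of the set in each level. -/
theorem exists_decoupling [NeZero d] {P : Measure (Env d)} [IsProbabilityMeasure P] {r : ℕ}
    {a C : ℝ} (ha : 0 < a) (hC : 0 < C) (h : MixingBound P r a C) :
    ∃ S : ℝ, 0 ≤ S ∧ ∀ (m : ℤ) (Δ : Finset (Site d)), (∀ y ∈ Δ, m + r ≤ y 0) →
      ∀ f g : Env d → ℝ≥0∞, Measurable f → Measurable g →
      (∀ ω ω' : Env d, (∀ x, x 0 < m → ω x = ω' x) → f ω = f ω') →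
      (∀ ω ω' : Env d, (∀ x ∈ Δ, ω x = ω' x) → g ω = g ω') →
      ∫⁻ ω, f ω * g ω ∂P ≤
        ENNReal.ofReal (Real.exp (S * ∑ y ∈ Δ, Real.exp (-(a / 2) * ((y 0 - m : ℤ) : ℝ)))) *
          (∫⁻ ω, f ω ∂P) * ∫⁻ ω, g ω ∂P := by
  classical
  set T := ∑' x : Site d, Real.exp (-(a / 2) * (dist1 x 0 : ℝ)) with hT
  have hT0 : 0 ≤ T := tsum_nonneg fun _ => (Real.exp_pos _).le
  refine ⟨C * T, by positivity, fun m Δ hΔ f g hf hg hfm hgΔ => ?_⟩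
  -- `V` is a union of balls around the sites `y` of `Δ`, of radius the height of `y` above `m`, cut
  -- off below `m`. It is finite and leaves all levels below `m` outside. A site outside `V` lies
  -- outside the ball of `y` or below `m`, so its distance to `y` is at least that height either
  -- way.
  set V : Finset (Site d) := Δ.biUnion fun y =>
    (finite_dist1_le y (y 0 - m).toNat).toFinset.filter fun x => m ≤ x 0 with hV
  have hmemV : ∀ x, x ∈ V ↔ ∃ y ∈ Δ, dist1 x y ≤ (y 0 - m).toNat ∧ m ≤ x 0 := by
    intro x
    simp [hV]
  have hΔV : Δ ⊆ V := fun y hy => (hmemV y).mpr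
    ⟨y, hy, by simp [dist1], by have := hΔ y hy; omega⟩
  have hdist : ∀ y ∈ Δ, ∀ x ∉ V, (y 0 - m : ℤ) ≤ dist1 x y := by
    intro y hy x hx
    by_contra! hlt
    refine hx ((hmemV x).mpr ⟨y, hy, by omega, ?_⟩)
    have := sub_le_dist1 x y 0
    omega
  -- With `A` the whole complement of `V`, the agreement condition is vacuous and all boundary
  -- conditions in `N` are comparable.
  obtain ⟨N, hN, hK⟩ := h Δ V hΔV
    (fun y hy x hx => by
      have h1 := hdist y hy x hx
      have h2 := hΔ y hy
      have h3 : dist1 y x = dist1 x y := by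
        simp only [dist1]; exact Finset.sum_congr rfl fun i _ => by omega
      omega) _ subset_rfl
  have hK' := fun η hη η' hη' => hK η hη η' hη' fun x hx => absurd x.2 hx
  refine (lintegral_mul_le_of_condLaw_le hN hK' hf hg (fun ω ω' hω => hfm ω ω' fun x hx => hω x ?_)
    hgΔ).trans ?_
  · intro hxV
    obtain ⟨y, -, -, hxm⟩ := (hmemV x).mp hxV
    omega
  · refine mul_le_mul_left (mul_le_mul_left (ENNReal.ofReal_le_ofReal (Real.exp_le_exp.mpr ?_)) _) _
    rw [mul_assoc]
    refine mul_le_mul_of_nonneg_left ?_ hC.le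
    have hs : ∀ y ∈ Δ, Summable fun x : ((V : Set (Site d))ᶜ : Set (Site d)) =>
        Real.exp (-a * (dist1 (x : Site d) y : ℝ)) :=
      fun y _ => (summable_exp_dist1_right ha y).subtype _
    rw [Summable.tsum_finsetSum hs, Finset.mul_sum]
    refine Finset.sum_le_sum fun y hy => tsum_exp_dist1_le ha y _ _ fun x hx => ?_
    exact_mod_cast hdist y hy x hx

end

/-! ### Uniform steps and the annealed law of the path -/

section
variable {d : ℕ}

/-- The uniform distribution on the steps. -/
noncomputable def uniformLaw (d : ℕ) : StepLaw d :=
  ⟨fun _ => ((Fintype.card (steps d) : ℝ))⁻¹, fun _ => by positivity, by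
    have : (Fintype.card (steps d) : ℝ) ≠ 0 := Nat.cast_ne_zero.mpr Fintype.card_ne_zero
    simp only [Finset.sum_const, Finset.card_univ, nsmul_eq_mul]
    exact mul_inv_cancel₀ this⟩

/-- Every step has probability at most one, which is the number of steps times the uniform
probability. -/
theorem stepKernel_le_of_uniform (ω ω' : Env d) (y : Site d) (h : ω' y = uniformLaw d)
    (s : Set (Site d)) : stepKernel ω y s ≤ (Fintype.card (steps d) : ℝ≥0∞) * stepKernel ω' y s := by
  change (∑ v : steps d, ENNReal.ofReal (ω y v) • Measure.dirac (y + (v : Site d))) _ ≤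
    _ * (∑ v : steps d, ENNReal.ofReal (ω' y v) • Measure.dirac (y + (v : Site d))) _
  simp only [Measure.coe_finsetSum, Finset.sum_apply, Measure.smul_apply, smul_eq_mul,
    Finset.mul_sum, ← mul_assoc]
  refine Finset.sum_le_sum fun v _ => mul_le_mul_left ?_ _
  have h0 : (Fintype.card (steps d) : ℝ) ≠ 0 := Nat.cast_ne_zero.mpr Fintype.card_ne_zero
  have h1 : (Fintype.card (steps d) : ℝ≥0∞) * ENNReal.ofReal (ω' y v) = 1 := by
    rw [h]
    change _ * ENNReal.ofReal (Fintype.card (steps d) : ℝ)⁻¹ = 1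
    rw [← ENNReal.ofReal_natCast, ← ENNReal.ofReal_mul (by positivity), mul_inv_cancel₀ h0,
      ENNReal.ofReal_one]
  rw [h1]
  refine ENNReal.ofReal_le_one.mpr ?_
  rw [← (ω y).2.2]
  exact Finset.single_le_sum (f := fun v => ω y v) (fun v _ => (ω y).2.1 v) (Finset.mem_univ v)

/-- The annealed law of the walk. -/
noncomputable def pathLaw (P : Measure (Env d)) : Measure (ℕ → Site d) :=
  P.bind (quenchedLaw 0)

theorem pathLaw_apply (P : Measure (Env d)) {A : Set (ℕ → Site d)} (hA : MeasurableSet A) :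
    pathLaw P A = ∫⁻ ω, quenchedLaw 0 ω A ∂P :=
  Measure.bind_apply hA (measurable_quenchedLaw 0).aemeasurable

instance instIsProbabilityMeasurePathLaw (P : Measure (Env d)) [IsProbabilityMeasure P] :
    IsProbabilityMeasure (pathLaw P) :=
  ⟨by simp [pathLaw, Measure.bind_apply .univ (measurable_quenchedLaw 0).aemeasurable]⟩

theorem lintegral_tsum_tsum {α : Type*} [MeasurableSpace α] {μ : Measure α} {β : ℕ → Type*}
    [∀ s, Countable (β s)] {f : ∀ s, β s → α → ℝ≥0∞} (hf : ∀ s b, Measurable (f s b)) :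
    ∫⁻ x, ∑' s, ∑' b, f s b x ∂μ = ∑' s, ∑' b, ∫⁻ x, f s b x ∂μ := by
  rw [lintegral_tsum fun s => (Measurable.tsum (hf s)).aemeasurable]
  exact tsum_congr fun s => lintegral_tsum fun b => (hf s b).aemeasurable

end

/-! ### Good stretches of the path -/

/-- `t` is the first time at which the level `m` is reached (and no higher one before). -/
def FirstHit {d : ℕ} [NeZero d] (X : ℕ → Site d) (m : ℤ) (t : ℕ) : Prop :=
  X t 0 = m ∧ ∀ s < t, X s 0 < m

/-- The walk first reaches level `L` above its start at time `s`, without backtracking by `h`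
before, and with at most `c (|j| + 1)²` earlier visits to the `j`-th level, for every `j`. -/
def goodUntil {d : ℕ} [NeZero d] (h L c s : ℕ) : Set (ℕ → Site d) :=
  {X | FirstHit X (X 0 0 + L) s ∧ (∀ t ≤ s, X 0 0 - h < X t 0) ∧
    ∀ j : ℤ, ((Finset.range s).filter fun t => X t 0 = X 0 0 + j).card ≤ c * (j.natAbs + 1) ^ 2}

/-- The event that `goodUntil` holds for some time. -/
def good {d : ℕ} [NeZero d] (h L c : ℕ) : Set (ℕ → Site d) := ⋃ s, goodUntil h L c s

/-- The path from the first visit to the level `m` on is good. -/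
def goodFrom {d : ℕ} [NeZero d] (h L c : ℕ) (m : ℤ) : Set (ℕ → Site d) :=
  {X | ∃ t, FirstHit X m t ∧ after t X ∈ good h L c}

/-- The paths that never come back to their starting level and visit the `j`-th level at most
`c (j + 1)²` times. -/
def neverR {d : ℕ} [NeZero d] (c : ℝ) : Set (ℕ → Site d) := {X | timeR c X = ⊤}

/-- The environment `ω` from level `k` on, and simple random walk below. -/
noncomputable def modify {d : ℕ} [NeZero d] (k : ℤ) (ω : Env d) : Env d :=
  fun x => if k ≤ x 0 then ω x else uniformLaw d

section
variable {d : ℕ} [NeZero d]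

theorem FirstHit.congr {X Y : ℕ → Site d} {m : ℤ} {t : ℕ} (h : ∀ i ≤ t, X i = Y i)
    (hX : FirstHit X m t) : FirstHit Y m t :=
  ⟨h t le_rfl ▸ hX.1, fun s hs => h s hs.le ▸ hX.2 s hs⟩

theorem FirstHit.unique {X : ℕ → Site d} {m : ℤ} {s t : ℕ} (hs : FirstHit X m s)
    (ht : FirstHit X m t) : s = t := by
  rcases lt_trichotomy s t with h | h | h
  · exact absurd hs.1 (ht.2 s h).ne
  · exact h
  · exact absurd ht.1 (hs.2 t h).ne

theorem determinedBy_firstHit (m : ℤ) (t : ℕ) : DeterminedBy t {X : ℕ → Site d | FirstHit X m t} :=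
  fun _ _ h hX => FirstHit.congr h hX

theorem determinedBy_goodUntil (h L c s : ℕ) :
    DeterminedBy s (goodUntil (d := d) h L c s) := by
  intro X Y hXY hX
  obtain ⟨h1, h2, h3⟩ := hX
  refine ⟨?_, fun t ht => ?_, fun j => ?_⟩
  · rw [← hXY 0 (Nat.zero_le _)]
    exact h1.congr hXY
  · rw [← hXY 0 (Nat.zero_le _), ← hXY t ht]
    exact h2 t ht
  · rw [← hXY 0 (Nat.zero_le _)]
    convert h3 j using 2
    refine Finset.filter_congr fun t ht => ?_
    rw [hXY t (Finset.mem_range.mp ht).le]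

theorem measurableSet_good (h L c : ℕ) : MeasurableSet (good (d := d) h L c) :=
  MeasurableSet.iUnion fun s => (determinedBy_goodUntil h L c s).measurableSet

theorem measurableSet_goodFrom (h L c : ℕ) (m : ℤ) :
    MeasurableSet (goodFrom (d := d) h L c m) := by
  have : goodFrom (d := d) h L c m =
      ⋃ t, ({X : ℕ → Site d | FirstHit X m t} ∩ after t ⁻¹' good h L c) := by
    ext X; simp [goodFrom]
  rw [this]
  exact MeasurableSet.iUnion fun t => (determinedBy_firstHit m t).measurableSet.inter
    (measurable_after t (measurableSet_good h L c))

theorem pairwise_disjoint_goodUntil (h L c : ℕ) :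
    Pairwise (Function.onFun Disjoint fun s => goodUntil (d := d) h L c s) := by
  intro s t hst
  exact Set.disjoint_left.mpr fun X hs ht => hst (hs.1.unique ht.1)

theorem measure_good (μ : Measure (ℕ → Site d)) (h L c : ℕ) :
    μ (good h L c) = ∑' s, ∑' γ : {γ : Fin (s + 1) → Site d | extend s γ ∈ goodUntil h L c s},
      μ (cyl s (extend s γ)) := by
  rw [good, measure_iUnion (pairwise_disjoint_goodUntil h L c)
    fun s => (determinedBy_goodUntil h L c s).measurableSet]
  exact tsum_congr fun s => (determinedBy_goodUntil h L c s).measure_eq_tsum μ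

/-! ### Comparison with the modified environment -/

theorem measurable_modify (k : ℤ) : Measurable (modify (d := d) k) := by
  refine measurable_pi_lambda _ fun x => ?_
  by_cases h : k ≤ x 0
  · simpa only [modify, if_pos h] using measurable_pi_apply _
  · simpa only [modify, if_neg h] using measurable_const

/-- This removes all dependence on the environment below level `k`, at the price of one factor per
visit there. -/
theorem weight_le_modify (ω : Env d) (k : ℤ) (s : ℕ) (γ : ℕ → Site d) :
    weight ω s γ ≤ (Fintype.card (steps d) : ℝ≥0∞) ^
      ((Finset.range s).filter fun t => γ t 0 < k).card * weight (modify k ω) s γ := by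
  have : ∀ t, stepKernel ω (γ t) {γ (t + 1)} ≤
      (if γ t 0 < k then (Fintype.card (steps d) : ℝ≥0∞) else 1) *
        stepKernel (modify k ω) (γ t) {γ (t + 1)} := by
    intro t
    split_ifs with h
    · exact stepKernel_le_of_uniform _ _ _ (by simp [modify, h.not_ge]) _
    · rw [one_mul]
      refine le_of_eq ?_
      change (∑ v : steps d, ENNReal.ofReal (ω (γ t) v) • Measure.dirac (γ t + (v : Site d))) _ =
        (∑ v : steps d, ENNReal.ofReal (modify k ω (γ t) v) • Measure.dirac (γ t + (v : Site d))) _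
      simp only [modify, if_pos (not_lt.mp h)]
  refine (Finset.prod_le_prod' fun t _ => this t).trans (le_of_eq ?_)
  rw [Finset.prod_mul_distrib, Finset.prod_ite, Finset.prod_const, Finset.prod_const_one, mul_one]
  rfl

/-- Only the levels strictly between `-h` and `r` relative to the start matter, and each has a
bounded number of visits. The bound does not involve `L` or `s`, so the price in `weight_le_modify`
is a constant. -/
theorem card_low_le {h L c s : ℕ} {γ : ℕ → Site d} (hγ : γ ∈ goodUntil h L c s) (r : ℕ) :
    ((Finset.range s).filter fun t => γ t 0 < γ 0 0 + r).card ≤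
      ∑ j ∈ Finset.Ioo (-(h : ℤ)) r, c * (j.natAbs + 1) ^ 2 := by
  classical
  obtain ⟨-, h2, h3⟩ := hγ
  refine (Finset.card_le_card (t := (Finset.Ioo (-(h : ℤ)) r).biUnion fun j =>
    (Finset.range s).filter fun t => γ t 0 = γ 0 0 + j) fun t ht => ?_).trans
      (Finset.card_biUnion_le.trans (Finset.sum_le_sum fun j _ => h3 j))
  simp only [Finset.mem_filter, Finset.mem_biUnion, Finset.mem_Ioo, Finset.mem_range] at ht ⊢
  have := h2 t ht.1.le
  exact ⟨γ t 0 - γ 0 0, ⟨by omega, by omega⟩, ht.1, by omega⟩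

theorem summable_sq_mul_exp (c : ℕ) {a : ℝ} (ha : 0 < a) :
    Summable fun j : ℕ => (c * (j + 1) ^ 2 : ℝ) * Real.exp (-a * j) := by
  have h1 := (summable_nat_add_iff 1).mpr (Real.summable_pow_mul_exp_neg_nat_mul 2 ha)
  refine (h1.mul_left (c * Real.exp a)).congr fun j => ?_
  have : Real.exp (-a * j) = Real.exp a * Real.exp (-a * (j + 1)) := by
    rw [← Real.exp_add]; congr 1; ring
  rw [this]; push_cast; ring

/-- The reason for restricting the visits per level: quadratic growth is beaten by exponential
mixing, so the bound is uniform in `L` and in the path. -/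
theorem sum_exp_le {h L c s : ℕ} {γ : ℕ → Site d} (hγ : γ ∈ goodUntil h L c s) {a : ℝ}
    (ha : 0 < a) (r : ℕ) [DecidableEq (Site d)] :
    ∑ y ∈ ((Finset.range s).filter fun t => γ 0 0 + r ≤ γ t 0).image γ,
      Real.exp (-a * ((y 0 - γ 0 0 : ℤ) : ℝ)) ≤
        ∑' j : ℕ, (c * (j + 1) ^ 2 : ℝ) * Real.exp (-a * j) := by
  set F := (Finset.range s).filter fun t => γ 0 0 + r ≤ γ t 0 with hF
  calc _ ≤ ∑ t ∈ F, Real.exp (-a * ((γ t 0 - γ 0 0 : ℤ) : ℝ)) :=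
        Finset.sum_image_le_of_nonneg (s := F) (g := γ)
          (f := fun y => Real.exp (-a * ((y 0 - γ 0 0 : ℤ) : ℝ))) fun _ _ => (Real.exp_pos _).le
    _ = ∑ t ∈ F, Real.exp (-a * (((γ t 0 - γ 0 0).toNat : ℕ) : ℝ)) := by
        refine Finset.sum_congr rfl fun t ht => ?_
        have := (Finset.mem_filter.mp ht).2
        congr 2
        have h0 : ((γ t 0 - γ 0 0).toNat : ℤ) = γ t 0 - γ 0 0 := by omega
        exact_mod_cast h0.symm
    _ = ∑ j ∈ F.image fun t => (γ t 0 - γ 0 0).toNat,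
          (F.filter fun t => (γ t 0 - γ 0 0).toNat = j).card • Real.exp (-a * (j : ℝ)) :=
        Finset.sum_comp (fun j : ℕ => Real.exp (-a * (j : ℝ))) fun t => (γ t 0 - γ 0 0).toNat
    _ ≤ ∑ j ∈ F.image fun t => (γ t 0 - γ 0 0).toNat,
          (c * (j + 1) ^ 2 : ℝ) * Real.exp (-a * j) := by
        refine Finset.sum_le_sum fun j _ => ?_
        rw [nsmul_eq_mul]
        refine mul_le_mul_of_nonneg_right ?_ (Real.exp_pos _).le
        have h1 : (F.filter fun t => (γ t 0 - γ 0 0).toNat = j).card ≤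
            c * ((j : ℤ).natAbs + 1) ^ 2 := by
          refine (Finset.card_le_card fun t ht => ?_).trans (hγ.2.2 j)
          simp only [hF, Finset.mem_filter, Finset.mem_range] at ht ⊢
          exact ⟨ht.1.1, by omega⟩
        rw [Int.natAbs_natCast] at h1
        exact_mod_cast h1
    _ ≤ _ := (summable_sq_mul_exp c ha).sum_le_tsum _ fun _ _ => by positivity

/-- The environment seen by a good stretch that starts at a record is comparable with a fresh
environment that is modified near the start. -/
theorem exists_lintegral_good_le {P : Measure (Env d)} [IsProbabilityMeasure P] {r : ℕ}
    {a C : ℝ} (ha : 0 < a) (hC : 0 < C) (hmix : MixingBound P r a C) (h c : ℕ) :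
    ∃ K : ℝ≥0∞, K ≠ ∞ ∧ ∀ (L n : ℕ) (π : ℕ → Site d), (∀ i < n, π i 0 < π n 0) →
      ∫⁻ ω, weight ω n π * quenchedLaw (π n) ω (good h L c) ∂P ≤
        K * (∫⁻ ω, weight ω n π ∂P) *
          ∫⁻ ω, quenchedLaw (π n) (modify (π n 0 + r) ω) (good h L c) ∂P := by
  classical
  obtain ⟨S, hS, hdec⟩ := exists_decoupling ha hC hmix
  -- `M` pays for replacing the environment below level `π n 0 + r`, and `E` for decoupling. Neither
  -- involves `L`, `n` or `π`.
  set M : ℝ≥0∞ := (Fintype.card (steps d) : ℝ≥0∞) ^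
    ∑ j ∈ Finset.Ioo (-(h : ℤ)) r, c * (j.natAbs + 1) ^ 2 with hM
  set E : ℝ≥0∞ := ENNReal.ofReal (Real.exp (S * ∑' j : ℕ, (c * (j + 1) ^ 2 : ℝ) *
    Real.exp (-(a / 2) * j))) with hE
  refine ⟨M * E, ENNReal.mul_ne_top (ENNReal.pow_ne_top (ENNReal.natCast_ne_top _))
    ENNReal.ofReal_ne_top, fun L n π hπ => ?_⟩
  have hcard : (1 : ℝ≥0∞) ≤ (Fintype.card (steps d) : ℝ≥0∞) := by
    exact_mod_cast Fintype.card_pos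
  set k : ℤ := π n 0 + r with hk
  have hmeas : ∀ (s : ℕ) (γ : ℕ → Site d), Measurable fun ω : Env d =>
      quenchedLaw (π n) ω (cyl s γ) := fun s γ =>
    (Measure.measurable_coe (measurableSet_cyl _ _)).comp (measurable_quenchedLaw _)
  have hterm : ∀ (s : ℕ) (γ : ℕ → Site d), γ ∈ goodUntil h L c s →
      ∫⁻ ω, weight ω n π * quenchedLaw (π n) ω (cyl s γ) ∂P ≤
        M * E * (∫⁻ ω, weight ω n π ∂P) *
          ∫⁻ ω, quenchedLaw (π n) (modify k ω) (cyl s γ) ∂P := by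
    intro s γ hγ
    simp only [quenchedLaw_cyl]
    split_ifs with h0
    swap
    · simp
    have hk' : k = γ 0 0 + r := by rw [h0, hk]
    calc ∫⁻ ω, weight ω n π * weight ω s γ ∂P
        ≤ ∫⁻ ω, M * (weight ω n π * weight (modify k ω) s γ) ∂P := by
          refine lintegral_mono fun ω => ?_
          change _ ≤ M * (weight ω n π * weight (modify k ω) s γ)
          rw [mul_left_comm]
          refine mul_le_mul_right ((weight_le_modify ω k s γ).trans (mul_le_mul_left ?_ _)) _
          refine pow_le_pow_right₀ hcard ?_
          rw [hk']
          exact card_low_le hγ r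
      _ = M * ∫⁻ ω, weight ω n π * weight (modify k ω) s γ ∂P :=
          lintegral_const_mul _ ((measurable_weight _ _).mul
            ((measurable_weight _ _).comp (measurable_modify k)))
      _ ≤ M * (E * (∫⁻ ω, weight ω n π ∂P) * ∫⁻ ω, weight (modify k ω) s γ ∂P) := by
          refine mul_le_mul_right ?_ _
          -- The past reads sites below level `π n 0` only; after the modification the stretch reads
          -- only its own sites from level `k` on, a finite set separated by `r` levels.
          refine (hdec (π n 0) (((Finset.range s).filter fun t => k ≤ γ t 0).image γ) ?_
            (fun ω => weight ω n π) (fun ω => weight (modify k ω) s γ) (measurable_weight _ _)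
            ((measurable_weight _ _).comp (measurable_modify k)) ?_ ?_).trans ?_
          · intro y hy
            obtain ⟨t, ht, rfl⟩ := Finset.mem_image.mp hy
            exact (Finset.mem_filter.mp ht).2
          · exact fun ω ω' hω => weight_congr (fun _ _ => rfl) fun i hi => hω _ (hπ i hi)
          · intro ω ω' hω
            refine weight_congr (fun _ _ => rfl) fun i hi => ?_
            simp only [modify]
            split_ifs with hki
            · exact hω _ (Finset.mem_image_of_mem _
                (Finset.mem_filter.mpr ⟨Finset.mem_range.mpr hi, hki⟩))
            · rfl
          · refine mul_le_mul_left (mul_le_mul_left (ENNReal.ofReal_le_ofReal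
              (Real.exp_le_exp.mpr (mul_le_mul_of_nonneg_left ?_ hS))) _) _
            have := sum_exp_le hγ (half_pos ha) r
            rw [← hk', h0] at this
            exact this
      _ = _ := by ring
  have hL : ∀ ω : Env d, weight ω n π * quenchedLaw (π n) ω (good h L c) =
      ∑' s, ∑' γ : {γ : Fin (s + 1) → Site d | extend s γ ∈ goodUntil h L c s},
        weight ω n π * quenchedLaw (π n) ω (cyl s (extend s γ)) := by
    intro ω
    simp only [measure_good, ENNReal.tsum_mul_left]
  simp only [hL]
  simp only [measure_good]
  rw [lintegral_tsum_tsum (β := fun s => {γ : Fin (s + 1) → Site d | extend s γ ∈ goodUntil h L c s})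
      (f := fun s γ ω => weight ω n π * quenchedLaw (π n) ω (cyl s (extend s γ)))
      fun s γ => (measurable_weight n π).mul (hmeas _ _),
    lintegral_tsum_tsum (β := fun s => {γ : Fin (s + 1) → Site d | extend s γ ∈ goodUntil h L c s})
      (f := fun s γ ω => quenchedLaw (π n) (modify k ω) (cyl s (extend s γ)))
      fun s γ => (hmeas _ _).comp (measurable_modify k),
    ← ENNReal.tsum_mul_left]
  refine ENNReal.tsum_le_tsum fun s => ?_
  rw [← ENNReal.tsum_mul_left]
  exact ENNReal.tsum_le_tsum fun γ => hterm s _ γ.2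

/-! ### Independence of separated good stretches -/

/-- A good stretch from level `m'` ends at the first hit of `m' + L ≤ m`, hence no later than the
first hit of `m`. -/
theorem determinedBy_goodFrom_inter {h L c : ℕ} {S : Finset ℕ} {m : ℕ} (hS : ∀ m' ∈ S, m' + L ≤ m)
    (t : ℕ) : DeterminedBy t ((⋂ m' ∈ S, goodFrom (d := d) h L c m') ∩
      {X : ℕ → Site d | FirstHit X m t}) := by
  rintro X Y hXY ⟨h1, h2⟩
  refine ⟨?_, FirstHit.congr hXY h2⟩
  simp only [Set.mem_iInter] at h1 ⊢
  intro m' hm'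
  obtain ⟨t', ht', hg⟩ := h1 m' hm'
  obtain ⟨s', hs'⟩ := Set.mem_iUnion.mp hg
  have hle : t' + s' ≤ t := by
    by_contra! hlt
    have hL := hS m' hm'
    have h2' : X t 0 = m := h2.1
    rcases lt_or_ge t t' with h | h
    · have := ht'.2 t h
      omega
    · have h3 := hs'.1.2 (t - t') (by omega)
      simp only [after] at h3
      rw [Nat.add_sub_cancel' h, add_zero, ht'.1] at h3
      omega
  refine ⟨t', FirstHit.congr (fun i hi => hXY i (by omega)) ht', Set.mem_iUnion.mpr ⟨s', ?_⟩⟩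
  exact determinedBy_goodUntil h L c s' _ _ (fun i hi => hXY _ (by omega)) hs'

/-- Decompose according to the path up to the first hit of `m`. It ends at a record and already
decides the earlier stretches, so the Markov property and `hε` apply to each piece. -/
theorem pathLaw_goodFrom_inter_le {P : Measure (Env d)} {h L c : ℕ}
    {ε : ℝ≥0∞} (hε : ∀ (n : ℕ) (π : ℕ → Site d), (∀ i < n, π i 0 < π n 0) →
      ∫⁻ ω, weight ω n π * quenchedLaw (π n) ω (good h L c) ∂P ≤ ε * ∫⁻ ω, weight ω n π ∂P)
    {S : Finset ℕ} {m : ℕ} (hS : ∀ m' ∈ S, m' + L ≤ m) :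
    pathLaw P (goodFrom h L c m ∩ ⋂ m' ∈ S, goodFrom (d := d) h L c m') ≤
      ε * pathLaw P (⋂ m' ∈ S, goodFrom (d := d) h L c m') := by
  set A := ⋂ m' ∈ S, goodFrom (d := d) h L c m' with hA
  have hAm : MeasurableSet A := Finset.measurableSet_biInter _ fun m' _ =>
    measurableSet_goodFrom h L c m'
  have hdet := fun t => determinedBy_goodFrom_inter (d := d) (h := h) (c := c) hS t
  set F : ℕ → Set (ℕ → Site d) := fun t => A ∩ {X : ℕ → Site d | FirstHit X m t} with hF
  have hFdet : ∀ t, DeterminedBy t (F t) := hdet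
  have hmeas : ∀ (t : ℕ) (γ : ℕ → Site d), Measurable fun ω : Env d =>
      quenchedLaw 0 ω (cyl t γ) := fun s γ =>
    (Measure.measurable_coe (measurableSet_cyl _ _)).comp (measurable_quenchedLaw _)
  have hmeasg : ∀ z, Measurable fun ω : Env d => quenchedLaw z ω (good h L c) := fun z =>
    (Measure.measurable_coe (measurableSet_good _ _ _)).comp (measurable_quenchedLaw z)
  have hdisj : Pairwise (Function.onFun Disjoint F) := fun s t hst =>
    Set.disjoint_left.mpr fun X hs ht => hst (hs.2.unique ht.2)
  have hsub : goodFrom h L c m ∩ A ⊆ ⋃ t, ⋃ γ : {γ : Fin (t + 1) → Site d | extend t γ ∈ F t},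
      (cyl t (extend t γ) ∩ after t ⁻¹' good h L c) := by
    rintro X ⟨⟨t, ht, hg⟩, hXA⟩
    have hX : ∀ i ≤ t, X i = extend t (fun i : Fin (t + 1) => X i) i := by
      intro i hi
      simp [extend, hi]
    exact Set.mem_iUnion.mpr ⟨t, Set.mem_iUnion.mpr ⟨⟨fun i => X i, hFdet t _ _ hX ⟨hXA, ht⟩⟩,
      hX, hg⟩⟩
  have hterm : ∀ (t : ℕ) (γ : ℕ → Site d), γ ∈ F t →
      ∫⁻ ω, quenchedLaw 0 ω (cyl t γ) * quenchedLaw (γ t) ω (good h L c) ∂P ≤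
        ε * ∫⁻ ω, quenchedLaw 0 ω (cyl t γ) ∂P := by
    intro t γ hγ
    simp only [quenchedLaw_cyl]
    split_ifs with h0
    · refine hε t γ fun i hi => ?_
      rw [hγ.2.1]
      exact hγ.2.2 i hi
    · simp
  calc pathLaw P (goodFrom h L c m ∩ A)
      = ∫⁻ ω, quenchedLaw 0 ω (goodFrom h L c m ∩ A) ∂P :=
        pathLaw_apply P ((measurableSet_goodFrom h L c m).inter hAm)
    _ ≤ ∫⁻ ω, ∑' t, ∑' γ : {γ : Fin (t + 1) → Site d | extend t γ ∈ F t},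
          quenchedLaw 0 ω (cyl t (extend t γ)) *
            quenchedLaw (extend t γ t) ω (good h L c) ∂P := by
        refine lintegral_mono fun ω => ?_
        refine (measure_mono hsub).trans ((measure_iUnion_le _).trans
          (ENNReal.tsum_le_tsum fun t => (measure_iUnion_le _).trans
            (ENNReal.tsum_le_tsum fun γ => ?_)))
        rw [quenchedLaw_cyl_inter _ _ _ _ (measurableSet_good h L c)]
    _ = ∑' t, ∑' γ : {γ : Fin (t + 1) → Site d | extend t γ ∈ F t},
          ∫⁻ ω, quenchedLaw 0 ω (cyl t (extend t γ)) *
            quenchedLaw (extend t γ t) ω (good h L c) ∂P := by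
        exact lintegral_tsum_tsum fun t γ => (hmeas _ _).mul (hmeasg _)
    _ ≤ ∑' t, ∑' γ : {γ : Fin (t + 1) → Site d | extend t γ ∈ F t},
          ε * ∫⁻ ω, quenchedLaw 0 ω (cyl t (extend t γ)) ∂P :=
        ENNReal.tsum_le_tsum fun t => ENNReal.tsum_le_tsum fun γ => hterm t _ γ.2
    _ = ε * ∫⁻ ω, ∑' t, quenchedLaw 0 ω (F t) ∂P := by
        simp only [ENNReal.tsum_mul_left]
        simp only [(hFdet _).measure_eq_tsum]
        rw [lintegral_tsum_tsum fun t γ => hmeas _ _]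
    _ ≤ ε * ∫⁻ ω, quenchedLaw 0 ω A ∂P := by
        refine mul_le_mul_right (lintegral_mono fun ω => ?_) _
        simp only
        rw [← measure_iUnion hdisj fun t => (hFdet t).measurableSet]
        exact measure_mono (Set.iUnion_subset fun t => Set.inter_subset_left)
    _ = ε * pathLaw P A := by rw [pathLaw_apply P hAm]

theorem pathLaw_biInter_goodFrom_le {P : Measure (Env d)} [IsProbabilityMeasure P] {h L c : ℕ}
    {ε : ℝ≥0∞} (hε : ∀ (n : ℕ) (π : ℕ → Site d), (∀ i < n, π i 0 < π n 0) →
      ∫⁻ ω, weight ω n π * quenchedLaw (π n) ω (good h L c) ∂P ≤ ε * ∫⁻ ω, weight ω n π ∂P)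
    (S : Finset ℕ) (hS : ∀ m ∈ S, ∀ m' ∈ S, m < m' → m + L ≤ m') :
    pathLaw P (⋂ m ∈ S, goodFrom (d := d) h L c m) ≤ ε ^ S.card := by
  classical
  induction S using Finset.induction_on_max with
  | empty => simp
  | insert m S hm ih =>
    rw [Finset.set_biInter_insert, Finset.card_insert_of_notMem fun h => (hm m h).false, pow_succ']
    refine (pathLaw_goodFrom_inter_le hε fun m' hm' => hS m' (Finset.mem_insert_of_mem hm') m
      (Finset.mem_insert_self _ _) (hm m' hm')).trans (mul_le_mul_right (ih fun a ha b hb => ?_) _)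
    exact hS a (Finset.mem_insert_of_mem ha) b (Finset.mem_insert_of_mem hb)

end

section
variable {d : ℕ} [NeZero d]

/-! ### Long good stretches are unlikely if `R` is always finite -/

theorem visits_eq_card (X : ℕ → Site d) (j n : ℕ) :
    visits X j n = ((Finset.range (n + 1)).filter fun t => X t 0 = X 0 0 + j).card := by
  classical
  rw [visits, Finset.card_filter]
  refine Finset.sum_congr rfl fun t _ => ?_
  simp only [level, Set.mem_ofPred_eq]
  congr

theorem mem_neverR {c : ℝ} {X : ℕ → Site d} : X ∈ neverR c ↔
    (∀ n j, (visits X j n : ℝ) ≤ c * ((j : ℝ) + 1) ^ 2) ∧ ∀ n, 1 ≤ n → X 0 0 < X n 0 := by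
  simp [neverR, timeR, backtrackTime, iInf_eq_top]

theorem measurableSet_neverR (c : ℝ) : MeasurableSet (neverR (d := d) c) := by
  have : neverR (d := d) c = (⋂ n, {X : ℕ → Site d | ∀ j, (visits X j n : ℝ) ≤ c * ((j : ℝ) + 1) ^ 2}) ∩
      ⋂ n, {X : ℕ → Site d | 1 ≤ n → X 0 0 < X n 0} := by
    ext X
    simp only [mem_neverR, Set.mem_inter_iff, Set.mem_iInter, Set.mem_ofPred_eq]
  rw [this]
  refine (MeasurableSet.iInter fun n => DeterminedBy.measurableSet (n := n) ?_).inter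
    (MeasurableSet.iInter fun n => DeterminedBy.measurableSet (n := n) ?_)
  · intro X Y h hX j
    refine le_of_eq_of_le ?_ (hX j)
    rw [visits_eq_card, visits_eq_card, ← h 0 (Nat.zero_le _)]
    refine congrArg (fun s : Finset ℕ => (s.card : ℝ)) (Finset.filter_congr fun t ht => ?_)
    rw [h t (Nat.lt_succ_iff.mp (Finset.mem_range.mp ht))]
  · intro X Y h hX hn
    rw [← h 0 (Nat.zero_le _), ← h n le_rfl]
    exact hX hn

theorem neverR_add (c : ℝ) (z : Site d) :
    (fun (X : ℕ → Site d) n => X n + z) ⁻¹' neverR c = neverR c := by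
  ext X
  simp only [Set.mem_preimage, mem_neverR, visits_eq_card, Pi.add_apply, add_lt_add_iff_right]
  simp only [add_right_comm _ (z 0), add_left_inj]

theorem good_add (h L c : ℕ) (z : Site d) :
    (fun (X : ℕ → Site d) n => X n + z) ⁻¹' good h L c = good h L c := by
  ext X
  simp only [good, goodUntil, FirstHit, Set.mem_preimage, Set.mem_iUnion, Set.mem_ofPred_eq,
    Pi.add_apply]
  simp only [add_right_comm _ (z 0), add_left_inj, add_lt_add_iff_right, add_sub_right_comm]

/-- `neverR` is invariant under translating the path, so invariance of `P` carries the null event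
from the origin to every site. Integer constants keep the exceptional sets countable in number. -/
theorem ae_quenchedLaw_neverR {P : Measure (Env d)} [IsProbabilityMeasure P]
    (hinv : TranslationInvariant P)
    (hnull : ∀ c : ℝ, 0 < c → annealedLaw P 0 {p | timeR c p.2 = ⊤} = 0) :
    ∀ᵐ ω ∂P, ∀ (z : Site d) (c : ℕ), quenchedLaw z ω (neverR ((c : ℝ) + 1)) = 0 := by
  rw [ae_all_iff]; intro z
  rw [ae_all_iff]; intro c
  have hm := measurableSet_neverR (d := d) ((c : ℝ) + 1)
  have h0 : ∫⁻ ω, quenchedLaw 0 ω (neverR ((c : ℝ) + 1)) ∂P = 0 := by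
    have := hnull (c + 1) (by positivity)
    rw [annealedLaw] at this
    have h1 := Measure.compProd_apply (μ := P) (κ := quenchedKernel (0 : Site d))
      (measurable_snd hm)
    exact h1.symm.trans this
  have hz : ∀ ω, quenchedLaw z ω (neverR ((c : ℝ) + 1)) =
      quenchedLaw 0 (shift z ω) (neverR ((c : ℝ) + 1)) := by
    intro ω
    rw [quenchedLaw_eq_map, Measure.map_apply (measurable_add_const z) hm, neverR_add]
  have hmeas : Measurable fun ω : Env d => quenchedLaw 0 ω (neverR ((c : ℝ) + 1)) :=
    (Measure.measurable_coe hm).comp (measurable_quenchedLaw 0)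
  have h1 : ∫⁻ ω, quenchedLaw z ω (neverR ((c : ℝ) + 1)) ∂P = 0 := by
    simp only [hz]
    rw [(hinv z).lintegral_comp hmeas, h0]
  exact (lintegral_eq_zero_iff ((Measure.measurable_coe hm).comp (measurable_quenchedLaw z))).mp h1

theorem lintegral_modify_good {P : Measure (Env d)} (hinv : TranslationInvariant P) (h L c r : ℕ)
    (y : Site d) : ∫⁻ ω, quenchedLaw y (modify (y 0 + r) ω) (good h L c) ∂P =
      ∫⁻ ω, quenchedLaw 0 (modify r ω) (good h L c) ∂P := by
  have hm := measurableSet_good (d := d) h L c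
  have hy : ∀ ω, quenchedLaw y (modify (y 0 + r) ω) (good h L c) =
      quenchedLaw 0 (modify r (shift y ω)) (good h L c) := by
    intro ω
    rw [quenchedLaw_eq_map, Measure.map_apply (measurable_add_const y) hm, good_add]
    congr 2
    ext1 x
    simp only [shift, modify, Pi.add_apply, add_comm (y 0), add_le_add_iff_right]
  simp only [hy]
  exact (hinv y).lintegral_comp
    ((Measure.measurable_coe hm).comp ((measurable_quenchedLaw 0).comp (measurable_modify _)))

/-- A path that is good on arbitrarily long stretches from its start is transient, and after its
last visit to a suitable level it never comes back. -/
theorem exists_after_mem_neverR {h c : ℕ} {X : ℕ → Site d} (hX : ∃ᶠ L in atTop, X ∈ good h L c)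
    {r : ℕ} (hr : 1 ≤ r) : ∃ n c' : ℕ, after n X ∈ neverR ((c' : ℝ) + 1) ∩
      staysIn {x | X 0 0 + r ≤ x 0} := by
  -- A level above everything seen up to time `N` is first reached after `N`, so the constraints of
  -- goodness hold along the entire path.
  have hlong : ∀ N, ∃ s, N ≤ s ∧ ∃ L, X ∈ goodUntil h L c s := by
    intro N
    obtain ⟨B, hB⟩ : ∃ B : ℕ, ∀ u ≤ N, X u 0 - X 0 0 ≤ B :=
      ⟨∑ u ∈ Finset.range (N + 1), (X u 0 - X 0 0).natAbs, fun u hu => by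
        have := Finset.single_le_sum (s := Finset.range (N + 1))
          (f := fun u => (X u 0 - X 0 0).natAbs) (fun _ _ => Nat.zero_le _) (Finset.mem_range.mpr (Nat.lt_succ_of_le hu))
        omega⟩
    obtain ⟨L, hL, hXL⟩ := frequently_atTop.mp hX (B + 1)
    obtain ⟨s, hs⟩ := Set.mem_iUnion.mp hXL
    refine ⟨s, ?_, L, hs⟩
    by_contra! hlt
    have h1 := hB s hlt.le
    have h2 := hs.1.1
    omega
  have hlow : ∀ t, X 0 0 - h < X t 0 := fun t => by
    obtain ⟨s, hts, L, hs⟩ := hlong t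
    exact hs.2.1 t hts
  have hcount : ∀ (j : ℤ) (N : ℕ), ((Finset.range N).filter fun t => X t 0 = X 0 0 + j).card ≤
      c * (j.natAbs + 1) ^ 2 := fun j N => by
    obtain ⟨s, hNs, L, hs⟩ := hlong N
    exact (Finset.card_le_card (Finset.filter_subset_filter _
      (Finset.range_subset_range.mpr hNs))).trans (hs.2.2 j)
  have hfin : ∀ j : ℤ, {t | X t 0 = X 0 0 + j}.Finite := by
    intro j
    by_contra hinf
    obtain ⟨S, hS, hcard⟩ := Set.Infinite.exists_subset_card_eq hinf (c * (j.natAbs + 1) ^ 2 + 1)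
    have h1 : S ⊆ (Finset.range (S.sup id + 1)).filter fun t => X t 0 = X 0 0 + j := fun t ht =>
      Finset.mem_filter.mpr ⟨Finset.mem_range.mpr
        (Nat.lt_succ_of_le (Finset.le_sup (f := id) ht)), hS ht⟩
    have := (Finset.card_le_card h1).trans (hcount j _)
    omega
  have hfin' : {t | X t 0 < X 0 0 + r}.Finite := by
    refine (Set.Finite.biUnion (Finset.Ioo (-(h : ℤ)) r).finite_toSet fun j _ => hfin j).subset
      fun t ht => ?_
    have h1 := hlow t
    have h2 : X t 0 < X 0 0 + r := ht
    simp only [Finset.coe_Ioo, Set.mem_iUnion, Set.mem_ofPred_eq, Set.mem_Ioo]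
    exact ⟨X t 0 - X 0 0, ⟨by omega, by omega⟩, by omega⟩
  obtain ⟨n₀, hn₀⟩ := hfin'.bddAbove
  have hhigh : ∀ t, n₀ < t → X 0 0 + r ≤ X t 0 := fun t ht => by
    by_contra! hlt
    exact absurd (hn₀ hlt) ht.not_ge
  -- `M` is the lowest level visited after the path has left the levels below `X 0 0 + r` for good.
  -- After the last visit `n` to `M` the path stays strictly above `M`.
  obtain ⟨M, ⟨t₁, ht₁, hM⟩, hmin⟩ := Int.exists_least_of_bdd (P := fun M => ∃ t, n₀ < t ∧ X t 0 = M)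
    ⟨X 0 0 + r, fun _ ⟨t, ht, hz⟩ => hz ▸ hhigh t ht⟩ ⟨_, n₀ + 1, Nat.lt_succ_self _, rfl⟩
  have hfinM : {t | n₀ < t ∧ X t 0 = M}.Finite :=
    (hfin (M - X 0 0)).subset fun t ht => by
      have := ht.2
      simp only [Set.mem_ofPred_eq]
      omega
  obtain ⟨n, ⟨hn, hnM⟩, hmax⟩ := Set.exists_max_image _ id hfinM ⟨t₁, ht₁, hM⟩
  have hrM : X 0 0 + r ≤ M := hnM ▸ hhigh n hn
  -- The constant absorbs the change of reference level, as `(M - X 0 0) + j + 1 ≤ ((M - X 0 0) + 1)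
  -- (j + 1)`.
  refine ⟨n, c * ((M - X 0 0).natAbs + 1) ^ 2, mem_neverR.mpr ⟨fun k j => ?_, fun k hk => ?_⟩,
    fun i => hhigh _ (by omega)⟩
  · have h1 : visits (after n X) j k ≤ c * ((M - X 0 0 + j).natAbs + 1) ^ 2 := by
      refine le_trans ?_ (hcount (M - X 0 0 + j) (n + (k + 1)))
      rw [visits_eq_card]
      refine Finset.card_le_card_of_injOn (fun t => n + t) (fun t ht => ?_) fun _ _ _ _ h => by
        simpa using h
      simp only [Finset.coe_filter, Finset.mem_range, Set.mem_ofPred_eq, after, add_zero] at ht ⊢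
      exact ⟨by omega, by omega⟩
    have h2 : (M - X 0 0 + j).natAbs + 1 ≤ ((M - X 0 0).natAbs + 1) * (j + 1) := by
      have : (M - X 0 0 + j).natAbs = (M - X 0 0).natAbs + j := by omega
      rw [this]
      nlinarith [Nat.zero_le ((M - X 0 0).natAbs * j)]
    have h3 : visits (after n X) j k ≤ c * ((M - X 0 0).natAbs + 1) ^ 2 * (j + 1) ^ 2 := by
      refine h1.trans ?_
      rw [mul_assoc, ← mul_pow]
      exact Nat.mul_le_mul_left _ (Nat.pow_le_pow_left h2 2)
    have h4 : (visits (after n X) j k : ℝ) ≤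
        ((c * ((M - X 0 0).natAbs + 1) ^ 2 : ℕ) : ℝ) * ((j : ℝ) + 1) ^ 2 := by
      exact_mod_cast h3
    refine h4.trans (mul_le_mul_of_nonneg_right (by linarith) (by positivity))
  · simp only [after, add_zero]
    rw [hnM]
    have hne : X (n + k) 0 ≠ M := fun heq => by
      have : n + k ≤ n := hmax (n + k) ⟨by omega, heq⟩
      omega
    exact lt_of_le_of_ne (hmin _ ⟨n + k, by omega, rfl⟩) hne.symm

/-- Goodness for infinitely many `L` is a null event, and continuity from above gives smallness for
some `L`. The modification does no harm: the part of the path that ends up in `neverR` stays where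
the environment is unchanged. -/
theorem exists_lintegral_modify_good_le {P : Measure (Env d)} [IsProbabilityMeasure P]
    (hinv : TranslationInvariant P)
    (hnull : ∀ c : ℝ, 0 < c → annealedLaw P 0 {p | timeR c p.2 = ⊤} = 0)
    (h c : ℕ) {r : ℕ} (hr : 1 ≤ r) {ε : ℝ≥0∞} (hε : 0 < ε) (L₀ : ℕ) :
    ∃ L ≥ L₀, ∀ y : Site d,
      ∫⁻ ω, quenchedLaw y (modify (y 0 + r) ω) (good h L c) ∂P ≤ ε := by
  set κ : Env d → Measure (ℕ → Site d) := fun ω => quenchedLaw 0 (modify r ω) with hκ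
  have hκm : Measurable κ := (measurable_quenchedLaw 0).comp (measurable_modify _)
  have hbind : ∀ {A : Set (ℕ → Site d)}, MeasurableSet A → (P.bind κ) A = ∫⁻ ω, κ ω A ∂P :=
    fun hA => Measure.bind_apply hA hκm.aemeasurable
  have : IsProbabilityMeasure (P.bind κ) :=
    ⟨by rw [hbind .univ]; simp [hκ]⟩
  set H : ℕ → Set (ℕ → Site d) := fun N => ⋃ L ≥ N, good h L c with hH
  have hHm : ∀ N, MeasurableSet (H N) := fun N =>
    MeasurableSet.biUnion (Set.to_countable _) fun L _ => measurableSet_good h L c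
  have hanti : Antitone H := fun N M hNM =>
    Set.biUnion_subset_biUnion_left fun L hL => le_trans hNM hL
  have hzero : (P.bind κ) (⋂ N, H N) = 0 := by
    have hm : Measurable fun ω => κ ω (⋂ N, H N) :=
      (Measure.measurable_coe (MeasurableSet.iInter hHm)).comp hκm
    rw [hbind (MeasurableSet.iInter hHm), lintegral_eq_zero_iff hm]
    filter_upwards [ae_quenchedLaw_neverR hinv hnull] with ω hω
    have hX0 : κ ω {X : ℕ → Site d | X 0 ≠ 0} = 0 := by
      have h1 : κ ω (cyl 0 fun _ => 0) = 1 := by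
        simp [hκ, quenchedLaw_cyl, weight]
      have h2 := (prob_compl_eq_zero_iff (μ := κ ω) (measurableSet_cyl 0 fun _ => 0)).mpr h1
      refine measure_mono_null (fun X hX => ?_) h2
      intro hc
      exact hX (hc 0 le_rfl)
    set B : ℕ → Set (ℕ → Site d) := fun c' => neverR ((c' : ℝ) + 1) ∩ staysIn {x | (r : ℤ) ≤ x 0}
    have hBm : ∀ c', MeasurableSet (B c') := fun c' =>
      (measurableSet_neverR _).inter (measurableSet_staysIn _)
    have hB : ∀ c' z, quenchedLaw z (modify r ω) (B c') = 0 := by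
      intro c' z
      rw [← quenchedLaw_inter_staysIn (ω := ω) (fun x hx => ?_) z (measurableSet_neverR _)]
      · exact measure_mono_null Set.inter_subset_left (hω z c')
      · exact (if_pos hx).symm
    refine measure_mono_null (t := {X : ℕ → Site d | X 0 ≠ 0} ∪ ⋃ n, ⋃ c', after n ⁻¹' B c')
      (fun X hX => ?_) (measure_union_null hX0 (measure_iUnion_null fun n =>
        measure_iUnion_null fun c' => quenchedLaw_after_eq_zero 0 _ n (hBm c') (hB c')))
    by_cases hX00 : X 0 = 0
    · right
      have hfreq : ∃ᶠ L in atTop, X ∈ good h L c := by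
        rw [frequently_atTop]
        intro N
        obtain ⟨L, hL, hXL⟩ := Set.mem_iUnion₂.mp (Set.mem_iInter.mp hX N)
        exact ⟨L, hL, hXL⟩
      obtain ⟨n, c', h1, h2⟩ := exists_after_mem_neverR hfreq hr
      refine Set.mem_iUnion.mpr ⟨n, Set.mem_iUnion.mpr ⟨c', h1, ?_⟩⟩
      simpa [hX00] using h2
    · exact Or.inl hX00
  have hlim := tendsto_measure_iInter_atTop (μ := P.bind κ)
    (fun N => (hHm N).nullMeasurableSet) hanti ⟨0, measure_ne_top _ _⟩
  rw [hzero] at hlim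
  obtain ⟨L, hL, hL₀⟩ := ((hlim.eventually (gt_mem_nhds hε)).and (eventually_ge_atTop L₀)).exists
  refine ⟨L, hL₀, fun y => ?_⟩
  rw [lintegral_modify_good hinv, ← hbind (measurableSet_good h L c)]
  exact (measure_mono (Set.subset_biUnion_of_mem (u := fun L => good h L c) le_rfl)).trans hL.le

/-- Under the assumption that `R` is almost surely finite, long good stretches are uniformly
unlikely given the past at a record time. -/
theorem exists_good_unlikely {P : Measure (Env d)} [IsProbabilityMeasure P]
    (hinv : TranslationInvariant P) (hG : ConditionG P)
    (hnull : ∀ c : ℝ, 0 < c → annealedLaw P 0 {p | timeR c p.2 = ⊤} = 0)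
    (h c : ℕ) {ε : ℝ≥0∞} (hε : 0 < ε) (L₀ : ℕ) :
    ∃ L ≥ L₀, ∀ (n : ℕ) (π : ℕ → Site d), (∀ i < n, π i 0 < π n 0) →
      ∫⁻ ω, weight ω n π * quenchedLaw (π n) ω (good h L c) ∂P ≤ ε * ∫⁻ ω, weight ω n π ∂P := by
  obtain ⟨r, hr, -, a, C, ha, hC, hmix⟩ := hG
  obtain ⟨K, hK, hle⟩ := exists_lintegral_good_le ha hC hmix h c
  -- `K` depends on `h` and `c` but not on `L`, so `L` may be chosen afterwards.
  obtain ⟨L, hL, hsmall⟩ := exists_lintegral_modify_good_le hinv hnull h c hr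
    (ENNReal.div_pos hε.ne' hK) L₀
  refine ⟨L, hL, fun n π hπ => (hle L n π hπ).trans ?_⟩
  calc K * (∫⁻ ω, weight ω n π ∂P) *
        ∫⁻ ω, quenchedLaw (π n) (modify (π n 0 + r) ω) (good h L c) ∂P
      ≤ K * (∫⁻ ω, weight ω n π ∂P) * (ε / K) := mul_le_mul_right (hsmall _) _
    _ = K * (ε / K) * ∫⁻ ω, weight ω n π ∂P := by ring
    _ ≤ ε * ∫⁻ ω, weight ω n π ∂P := mul_le_mul_left ENNReal.mul_div_le _

end

section
variable {d : ℕ} [NeZero d]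

/-! ### Paths of positive speed have many good stretches -/

theorem exists_firstHit {X : ℕ → Site d} (hX : ∀ n, |X (n + 1) 0 - X n 0| ≤ 1) {m : ℤ} {k : ℕ}
    (h0 : X 0 0 ≤ m) (hk : m ≤ X k 0) : ∃ t ≤ k, FirstHit X m t := by
  classical
  have hex : ∃ t, m ≤ X t 0 := ⟨k, hk⟩
  refine ⟨Nat.find hex, Nat.find_min' hex hk, ?_, fun s hs => not_le.mp (Nat.find_min hex hs)⟩
  refine le_antisymm ?_ (Nat.find_spec hex)
  rcases Nat.eq_zero_or_pos (Nat.find hex) with h | h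
  · rw [h]; exact h0
  · have h1 := not_le.mp (Nat.find_min hex (Nat.sub_lt h Nat.one_pos))
    have h2 := hX (Nat.find hex - 1)
    rw [Nat.sub_add_cancel h] at h2
    have := abs_le.mp h2
    omega

theorem abs_sub_le_of_steps {X : ℕ → Site d} (hX : ∀ n, |X (n + 1) 0 - X n 0| ≤ 1) (n k : ℕ) :
    X n 0 - k ≤ X (n + k) 0 := by
  induction k with
  | zero => simp
  | succ k ih =>
    have := abs_le.mp (hX (n + k))
    rw [← add_assoc]
    push_cast
    omega

/-- At the largest scale `i` with `h i ≤ b` the term is at most `b`. The earlier terms add up to at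
most the sum of the earlier `L`, which is at most `h i ≤ b`. -/
theorem sum_scales_le {h L : ℕ → ℕ} (hL : ∀ i, h i ≤ L i) (hh : ∀ i, 2 * L i ≤ h (i + 1)) (b J : ℕ) :
    ∑ i ∈ Finset.range J, (if h i ≤ b then min b (L i) else 0) ≤ 2 * b := by
  have hsum : ∀ J, ∑ i ∈ Finset.range J, L i ≤ h J := by
    intro J
    induction J with
    | zero => simp
    | succ J ih =>
      rw [Finset.sum_range_succ]
      have := hL J
      have := hh J
      omega
  induction J with
  | zero => simp
  | succ J ih =>
    rw [Finset.sum_range_succ]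
    split_ifs with hb
    · have h1 : ∑ i ∈ Finset.range J, (if h i ≤ b then min b (L i) else 0) ≤
          ∑ i ∈ Finset.range J, L i := Finset.sum_le_sum fun i _ => by
        split_ifs
        · exact min_le_right _ _
        · exact Nat.zero_le _
      have := hsum J
      have := min_le_left b (L J)
      omega
    · simpa using ih

/-- Few levels `m` see too many visits to some level nearby. -/
theorem card_crowded_le (Z : ℕ → ℤ) (c n T : ℕ) [DecidablePred fun m : ℕ => ∃ j : ℤ,
      c * (j.natAbs + 1) ^ 2 < ((Finset.range T).filter fun t => Z t = m + j).card] :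
    c * ((Finset.range n).filter fun m : ℕ => ∃ j : ℤ,
      c * (j.natAbs + 1) ^ 2 < ((Finset.range T).filter fun t => Z t = m + j).card).card ≤ 2 * T := by
  classical
  rcases Nat.eq_zero_or_pos c with rfl | hc
  · simp
  set K := (Finset.range T).image Z with hK
  set N : ℤ → ℕ := fun k => ((Finset.range T).filter fun t => Z t = k).card with hN
  have hsub : ((Finset.range n).filter fun m : ℕ => ∃ j : ℤ,
      c * (j.natAbs + 1) ^ 2 < ((Finset.range T).filter fun t => Z t = m + j).card) ⊆
      K.biUnion fun k => (Finset.range n).filter fun m : ℕ =>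
        c * ((k - m).natAbs + 1) ^ 2 < N k := by
    intro m hm
    obtain ⟨hmn, j, hj⟩ := Finset.mem_filter.mp hm
    obtain ⟨t, ht⟩ := Finset.card_pos.mp (lt_of_le_of_lt (Nat.zero_le _) hj)
    obtain ⟨htT, htj⟩ := Finset.mem_filter.mp ht
    refine Finset.mem_biUnion.mpr ⟨m + j, htj ▸ Finset.mem_image_of_mem _ htT,
      Finset.mem_filter.mpr ⟨hmn, ?_⟩⟩
    simpa using hj
  have hcount : ∀ k : ℤ, c * ((Finset.range n).filter fun m : ℕ =>
      c * ((k - m).natAbs + 1) ^ 2 < N k).card ≤ 2 * N k := by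
    intro k
    -- Level `k` crowds only the `m` at distance less than `q`, fewer than `2 q` of them if `q > 0`,
    -- and `c q ≤ c q² ≤ N k`.
    set q := Nat.sqrt (N k / c) with hq
    have h1 : ((Finset.range n).filter fun m : ℕ => c * ((k - m).natAbs + 1) ^ 2 < N k).card ≤
        (Finset.Ioo (k - q) (k + q)).card := by
      refine Finset.card_le_card_of_injOn (fun m : ℕ => (m : ℤ)) (fun m hm => ?_)
        fun _ _ _ _ h => by simpa using h
      have hm' := (Finset.mem_filter.mp hm).2
      have : (k - m).natAbs + 1 ≤ q := by
        rw [hq, Nat.le_sqrt', Nat.le_div_iff_mul_le hc, mul_comm]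
        exact hm'.le
      simp only [Finset.coe_Ioo, Set.mem_Ioo]
      omega
    rw [Int.card_Ioo] at h1
    have h2 : ((Finset.range n).filter fun m : ℕ =>
        c * ((k - m).natAbs + 1) ^ 2 < N k).card ≤ 2 * q := by omega
    have h3 : c * q ≤ N k := by
      have h4 : q ≤ N k / c := (Nat.le_self_pow two_ne_zero q).trans (Nat.sqrt_le' _)
      calc c * q ≤ c * (N k / c) := Nat.mul_le_mul_left _ h4
        _ ≤ N k := Nat.mul_div_le _ _
    calc _ ≤ c * (2 * q) := Nat.mul_le_mul_left _ h2
      _ ≤ 2 * N k := by nlinarith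
  calc _ ≤ c * ∑ k ∈ K, ((Finset.range n).filter fun m : ℕ =>
        c * ((k - m).natAbs + 1) ^ 2 < N k).card :=
        Nat.mul_le_mul_left _ ((Finset.card_le_card hsub).trans Finset.card_biUnion_le)
    _ ≤ ∑ k ∈ K, 2 * N k := by
        rw [Finset.mul_sum]
        exact Finset.sum_le_sum fun k _ => hcount k
    _ = 2 * T := by
        rw [← Finset.mul_sum, hN, ← Finset.card_eq_sum_card_image, Finset.card_range]

open Classical in
/-- If the level `n` is reached within time `A n`, then on one of `8 A` well-separated scales more
than a quarter of the levels start a good stretch. -/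
theorem exists_many_good {X : ℕ → Site d} (hX0 : X 0 0 = 0)
    (hX : ∀ n, |X (n + 1) 0 - X n 0| ≤ 1) {A n τ : ℕ} (hA : 0 < A) (hτ : FirstHit X n τ)
    (hτA : τ ≤ A * n) {h L : ℕ → ℕ} (h1 : ∀ i, 1 ≤ h i) (hL : ∀ i, h i ≤ L i)
    (hh : ∀ i, 2 * L i ≤ h (i + 1)) (hn : ∀ i < 8 * A, 4 * L i < n) :
    ∃ i < 8 * A, n < 4 * ((Finset.range n).filter fun m : ℕ =>
      X ∈ goodFrom (h i) (L i) (8 * A) m).card := by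
  have hex : ∀ m : ℕ, m ≤ n → ∃ t, FirstHit X m t := fun m hm => by
    obtain ⟨t, -, ht⟩ := exists_firstHit (m := m) (k := τ) hX (by omega) (by
      rw [hτ.1]; exact_mod_cast hm)
    exact ⟨t, ht⟩
  choose! T hT using hex
  have hTn : T n = τ := (hT n le_rfl).unique hτ
  have hmono : ∀ m m', m ≤ m' → m' ≤ n → T m ≤ T m' := fun m m' hmm hm' => by
    by_contra! hlt
    have := (hT m (hmm.trans hm')).2 _ hlt
    rw [(hT m' hm').1] at this
    omega
  have hT0 : T 0 = 0 := by
    have h00 : FirstHit X (0 : ℕ) 0 := ⟨by simpa using hX0, fun s hs => absurd hs (Nat.not_lt_zero s)⟩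
    exact (hT 0 (Nat.zero_le _)).unique h00
  set b : ℕ → ℕ := fun w => T (w + 1) - T w with hb
  have hbsum : ∀ k ≤ n, ∑ w ∈ Finset.range k, b w = T k := by
    intro k
    induction k with
    | zero => simp [hT0]
    | succ k ih =>
      intro hk
      rw [Finset.sum_range_succ, ih (by omega)]
      have := hmono k (k + 1) (by omega) hk
      simp only [hb]
      omega
  set back : ℕ → Finset ℕ := fun i => (Finset.range n).filter fun m => m + L i ≤ n ∧
    ∃ t, T m ≤ t ∧ t < T (m + L i) ∧ X t 0 ≤ m - h i with hback
  -- A fall from a stretch started at `m` occurs between the first hits of some `w` and `w + 1`,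
  -- with `m ≤ w < m + L i`. It descends at least `w - m + h i`, so it takes that long, which limits
  -- the number of possible `m` for each `w`.
  have hbackcard : ∀ i, (back i).card ≤
      ∑ w ∈ Finset.range n, if h i ≤ b w then min (b w) (L i) else 0 := by
    intro i
    have hsub : back i ⊆ (Finset.range n).biUnion fun w =>
        (Finset.range n).filter fun m => m ≤ w ∧ w < m + L i ∧ w - m + h i ≤ b w := by
      intro m hm
      obtain ⟨hmn, hmL, t, ht1, ht2, ht3⟩ := Finset.mem_filter.mp hm
      have hex : ∃ w, t < T (m + w + 1) := by
        refine ⟨L i - 1, ?_⟩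
        have := (h1 i).trans (hL i)
        rwa [add_assoc, Nat.sub_add_cancel this]
      have hw1 := Nat.find_spec hex
      set w := Nat.find hex with hw
      have hwL : w < L i := by
        have : w ≤ L i - 1 := Nat.find_min' hex (by
          have := (h1 i).trans (hL i)
          rwa [add_assoc, Nat.sub_add_cancel this])
        have := (h1 i).trans (hL i)
        omega
      have hw2 : T (m + w) ≤ t := by
        rcases Nat.eq_zero_or_pos w with h0 | h0
        · rw [h0]; exact ht1
        · have := Nat.find_min hex (Nat.sub_lt h0 Nat.one_pos)
          rw [← hw, add_assoc, Nat.sub_add_cancel h0] at this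
          omega
      have hfall := abs_sub_le_of_steps hX (T (m + w)) (t - T (m + w))
      rw [Nat.add_sub_cancel' hw2, (hT (m + w) (by omega)).1] at hfall
      refine Finset.mem_biUnion.mpr ⟨m + w, Finset.mem_range.mpr (by omega),
        Finset.mem_filter.mpr ⟨hmn, by omega, by omega, ?_⟩⟩
      simp only [hb]
      push_cast at hfall
      omega
    refine (Finset.card_le_card hsub).trans (Finset.card_biUnion_le.trans
      (Finset.sum_le_sum fun w _ => ?_))
    have hinj : ((Finset.range n).filter fun m => m ≤ w ∧ w < m + L i ∧ w - m + h i ≤ b w).card ≤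
        (Finset.range (min (L i) (b w + 1 - h i))).card := by
      refine Finset.card_le_card_of_injOn (fun m => w - m) (fun m hm => ?_) fun m hm m' hm' heq => ?_
      · have := (Finset.mem_filter.mp hm).2
        simp only [Finset.coe_range, Set.mem_Iio]
        omega
      · have := (Finset.mem_filter.mp hm).2
        have := (Finset.mem_filter.mp hm').2
        simp only at heq
        omega
    rw [Finset.card_range] at hinj
    have := h1 i
    split_ifs with hib
    · omega
    · omega
  have hbacksum : ∑ i ∈ Finset.range (8 * A), (back i).card ≤ 2 * (A * n) := by
    calc _ ≤ ∑ i ∈ Finset.range (8 * A),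
          ∑ w ∈ Finset.range n, (if h i ≤ b w then min (b w) (L i) else 0) :=
          Finset.sum_le_sum fun i _ => hbackcard i
      _ = ∑ w ∈ Finset.range n, ∑ i ∈ Finset.range (8 * A),
            (if h i ≤ b w then min (b w) (L i) else 0) := Finset.sum_comm
      _ ≤ ∑ w ∈ Finset.range n, 2 * b w := Finset.sum_le_sum fun w _ => sum_scales_le hL hh _ _
      _ = 2 * τ := by rw [← Finset.mul_sum, hbsum n le_rfl, hTn]
      _ ≤ _ := Nat.mul_le_mul_left _ hτA
  -- If each of the `8 A` sets had more than `n / 4` elements, the total would exceed `2 A n`.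
  obtain ⟨i, hi, hile⟩ : ∃ i < 8 * A, 4 * (back i).card ≤ n := by
    by_contra! hcon
    have : ∑ _i ∈ Finset.range (8 * A), (n + 1) ≤ ∑ i ∈ Finset.range (8 * A), 4 * (back i).card :=
      Finset.sum_le_sum fun i hi => hcon i (Finset.mem_range.mp hi)
    rw [← Finset.mul_sum, Finset.sum_const, Finset.card_range, smul_eq_mul] at this
    nlinarith
  refine ⟨i, hi, ?_⟩
  set crowded := (Finset.range n).filter fun m : ℕ => ∃ j : ℤ,
      8 * A * (j.natAbs + 1) ^ 2 < ((Finset.range τ).filter fun t => X t 0 = m + j).card with hcr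
  have hcrowded : 4 * crowded.card ≤ n := by
    have h2 := card_crowded_le (fun t => X t 0) (8 * A) n τ
    have h3 : 8 * A * crowded.card ≤ 2 * τ := by
      convert h2
    nlinarith
  -- The bad levels are those that backtrack, those that are crowded and the last `L i`: at most a
  -- quarter each, strictly less for the last.
  have hcover : Finset.range n ⊆ ((Finset.range n).filter fun m : ℕ =>
      X ∈ goodFrom (h i) (L i) (8 * A) m) ∪ (back i ∪ (crowded ∪ Finset.Ico (n - L i) n)) := by
    intro m hm
    simp only [Finset.mem_union]
    by_cases hmL : m + L i ≤ n
    swap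
    · right; right; right
      rw [Finset.mem_Ico]
      have := Finset.mem_range.mp hm
      omega
    by_cases hmb : m ∈ back i
    · exact Or.inr (Or.inl hmb)
    by_cases hmc : m ∈ crowded
    · exact Or.inr (Or.inr (Or.inl hmc))
    left
    have hTm := hT m (by omega)
    have hTmL := hT (m + L i) hmL
    have hle : T m ≤ T (m + L i) := hmono m (m + L i) (by omega) hmL
    refine Finset.mem_filter.mpr ⟨hm, T m, hTm, Set.mem_iUnion.mpr ⟨T (m + L i) - T m, ?_, ?_, ?_⟩⟩
    · simp only [FirstHit, after, add_zero, hTm.1]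
      rw [Nat.add_sub_cancel' hle]
      refine ⟨by rw [hTmL.1]; push_cast; rfl, fun s hs => ?_⟩
      have := hTmL.2 (T m + s) (by omega)
      push_cast at this
      exact this
    · intro t ht
      simp only [after, add_zero, hTm.1]
      by_contra! hlt
      refine hmb (Finset.mem_filter.mpr ⟨hm, hmL, T m + t, by omega, ?_, hlt⟩)
      refine lt_of_le_of_ne (by omega) fun heq => ?_
      rw [heq, hTmL.1] at hlt
      push_cast at hlt
      have := h1 i
      omega
    · intro j
      by_contra! hlt
      refine hmc (Finset.mem_filter.mpr ⟨hm, j, lt_of_lt_of_le hlt ?_⟩)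
      refine Finset.card_le_card_of_injOn (fun t => T m + t) (fun t ht => ?_) fun _ _ _ _ h => by
        simpa using h
      have hτL : T (m + L i) ≤ τ := hTn ▸ hmono (m + L i) n hmL le_rfl
      simp only [Finset.coe_filter, Finset.mem_range, Set.mem_ofPred_eq, after, add_zero,
        hTm.1] at ht ⊢
      exact ⟨by omega, ht.2⟩
  have hcard := Finset.card_le_card hcover
  have hu1 := Finset.card_union_le ((Finset.range n).filter fun m : ℕ =>
      X ∈ goodFrom (h i) (L i) (8 * A) m) (back i ∪ (crowded ∪ Finset.Ico (n - L i) n))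
  have hu2 := Finset.card_union_le (back i) (crowded ∪ Finset.Ico (n - L i) n)
  have hu3 := Finset.card_union_le crowded (Finset.Ico (n - L i) n)
  rw [Finset.card_range] at hcard
  rw [Nat.card_Ico] at hu3
  have := hn i hi
  omega

end

section
variable {d : ℕ}

/-! ### Long time behaviour -/

theorem tsum_half_pow_div (K : ℕ) [NeZero K] :
    ∑' n : ℕ, (2⁻¹ : ℝ≥0∞) ^ (n / K + 1) ≠ ∞ := by
  have h1 : ∑' n : ℕ, (2⁻¹ : ℝ≥0∞) ^ (n / K + 1) =
      ∑' p : ℕ × Fin K, (2⁻¹ : ℝ≥0∞) ^ (p.1 + 1) := by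
    rw [← (Nat.divModEquiv K).tsum_eq]
    exact tsum_congr fun n => by simp [Nat.divModEquiv]
  rw [h1, ENNReal.tsum_prod (f := fun (q : ℕ) (_ : Fin K) => (2⁻¹ : ℝ≥0∞) ^ (q + 1))]
  simp only [tsum_fintype, Finset.sum_const, Finset.card_univ, Fintype.card_fin, nsmul_eq_mul]
  rw [ENNReal.tsum_mul_left]
  simp only [pow_succ]
  rw [ENNReal.tsum_mul_right, ENNReal.tsum_geometric]
  refine ENNReal.mul_ne_top (ENNReal.natCast_ne_top _) (ENNReal.mul_ne_top ?_ (by simp))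
  simp

open Classical in
/-- A union bound: if separated families of events are exponentially unlikely, then almost surely
only finitely often a quarter of the first `n` events occur. -/
theorem ae_eventually_card_le {Ω : Type*} [MeasurableSpace Ω] {μ : Measure Ω} {G : ℕ → Set Ω}
    {L : ℕ} (hL : 0 < L)
    (h : ∀ S : Finset ℕ, (∀ m ∈ S, ∀ m' ∈ S, m < m' → m + L ≤ m') →
      μ (⋂ m ∈ S, G m) ≤ (2⁻¹ ^ 5) ^ S.card) :
    μ {x | ∃ᶠ n in atTop, n < 4 * ((Finset.range n).filter fun m => x ∈ G m).card} = 0 := by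
  have : NeZero (4 * L) := ⟨by omega⟩
  have hbound : ∀ n, μ {x | n < 4 * ((Finset.range n).filter fun m => x ∈ G m).card} ≤
      L * 2⁻¹ ^ (n / (4 * L) + 1) := by
    intro n
    -- More than `n / 4` occurrences force at least `k` of them into one residue class modulo `L`. A
    -- class has at most `4 k` candidates, hence at most `2 ^ (4 k)` subsets, and the factor `2⁻¹ ^
    -- 5` per event leaves `2⁻¹ ^ k`.
    set k := n / (4 * L) + 1 with hk
    have hnk : n < 4 * L * k := Nat.lt_mul_div_succ n (by omega)
    set C : ℕ → Finset ℕ := fun ρ => (Finset.range n).filter fun m => m % L = ρ with hC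
    have hCcard : ∀ ρ, (C ρ).card ≤ 4 * k := by
      intro ρ
      have : (C ρ).card ≤ (Finset.range (4 * k)).card := by
        refine Finset.card_le_card_of_injOn (fun m => m / L) (fun m hm => ?_) fun m hm m' hm' heq => ?_
        · have hmn := Finset.mem_range.mp (Finset.mem_filter.mp hm).1
          simp only [Finset.coe_range, Set.mem_Iio]
          rw [Nat.div_lt_iff_lt_mul hL]
          nlinarith
        · have h1 := (Finset.mem_filter.mp hm).2
          have h2 := (Finset.mem_filter.mp hm').2
          rw [← Nat.div_add_mod m L, ← Nat.div_add_mod m' L, h1, h2]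
          simp only at heq
          rw [heq]
      simpa using this
    set 𝒮 : ℕ → Finset (Finset ℕ) := fun ρ => (C ρ).powerset.filter fun S => k ≤ S.card with h𝒮
    have hsub : {x | n < 4 * ((Finset.range n).filter fun m => x ∈ G m).card} ⊆
        ⋃ ρ ∈ Finset.range L, ⋃ S ∈ 𝒮 ρ, ⋂ m ∈ S, G m := by
      intro x hx
      have hx' : n < 4 * ((Finset.range n).filter fun m => x ∈ G m).card := hx
      obtain ⟨ρ, hρ, hle⟩ : ∃ ρ < L, k ≤ ((C ρ).filter fun m => x ∈ G m).card := by
        by_contra! hcon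
        have hfib : ((Finset.range n).filter fun m => x ∈ G m).card =
            ∑ ρ ∈ Finset.range L, ((C ρ).filter fun m => x ∈ G m).card := by
          rw [Finset.card_eq_sum_card_fiberwise (f := fun m => m % L) (t := Finset.range L)
            fun m _ => by simpa using Nat.mod_lt m hL]
          refine Finset.sum_congr rfl fun ρ _ => congrArg _ ?_
          simp only [hC, Finset.filter_filter]
          exact Finset.filter_congr fun _ _ => and_comm
        have hle : ∑ ρ ∈ Finset.range L, ((C ρ).filter fun m => x ∈ G m).card ≤ L * (k - 1) := by
          refine (Finset.sum_le_card_nsmul _ _ (k - 1) fun ρ hρ => ?_).trans (by simp)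
          have := hcon ρ (Finset.mem_range.mp hρ)
          omega
        rw [← hfib, hk, Nat.add_sub_cancel] at hle
        have := Nat.div_mul_le_self n (4 * L)
        nlinarith
      refine Set.mem_biUnion (Finset.mem_range.mpr hρ) (Set.mem_biUnion (Finset.mem_filter.mpr
        ⟨Finset.mem_powerset.mpr (Finset.filter_subset _ _), hle⟩) ?_)
      exact Set.mem_iInter₂.mpr fun m hm => (Finset.mem_filter.mp hm).2
    have hS : ∀ ρ, ∀ S ∈ 𝒮 ρ, μ (⋂ m ∈ S, G m) ≤ (2⁻¹ ^ 5) ^ k := by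
      intro ρ S hS
      obtain ⟨hSC, hkS⟩ := Finset.mem_filter.mp hS
      refine (h S fun m hm m' hm' hlt => ?_).trans (pow_le_pow_right_of_le_one' ?_ hkS)
      · have h1 := (Finset.mem_filter.mp (Finset.mem_powerset.mp hSC hm)).2
        have h2 := (Finset.mem_filter.mp (Finset.mem_powerset.mp hSC hm')).2
        have h3 : L ∣ m' - m := (Nat.modEq_iff_dvd' hlt.le).mp (h1.trans h2.symm)
        have := Nat.le_of_dvd (by omega) h3
        omega
      · exact pow_le_one' (by simp) 5
    calc _ ≤ ∑ ρ ∈ Finset.range L, ∑ S ∈ 𝒮 ρ, μ (⋂ m ∈ S, G m) :=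
          (measure_mono hsub).trans ((measure_biUnion_finset_le _ _).trans
            (Finset.sum_le_sum fun ρ _ => measure_biUnion_finset_le _ _))
      _ ≤ ∑ ρ ∈ Finset.range L, 2 ^ (4 * k) * (2⁻¹ ^ 5) ^ k := by
          refine Finset.sum_le_sum fun ρ _ => ?_
          refine (Finset.sum_le_card_nsmul _ _ _ (hS ρ)).trans ?_
          rw [nsmul_eq_mul]
          refine mul_le_mul_left ?_ _
          have h1 : (𝒮 ρ).card ≤ 2 ^ (4 * k) :=
            (Finset.card_filter_le _ _).trans (by
              rw [Finset.card_powerset]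
              exact Nat.pow_le_pow_right (by norm_num) (hCcard ρ))
          exact_mod_cast h1
      _ = L * 2⁻¹ ^ k := by
          rw [Finset.sum_const, Finset.card_range, nsmul_eq_mul]
          congr 1
          have h2 : (2 : ℝ≥0∞) ^ 4 * 2⁻¹ ^ 4 = 1 := by
            rw [← mul_pow, ENNReal.mul_inv_cancel (by norm_num) (by norm_num), one_pow]
          have h3 : (2 : ℝ≥0∞) ^ 4 * 2⁻¹ ^ 5 = 2⁻¹ := by
            rw [pow_succ 2⁻¹ 4, ← mul_assoc, h2, one_mul]
          rw [pow_mul, ← mul_pow, h3]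
  refine measure_setOfPred_frequently_eq_zero (ne_top_of_le_ne_top ?_ (ENNReal.tsum_le_tsum hbound))
  rw [ENNReal.tsum_mul_left]
  exact ENNReal.mul_ne_top (ENNReal.natCast_ne_top _) (tsum_half_pow_div (4 * L))

/-! ### Nearest-neighbour paths, linear hitting times and the conclusion -/

theorem steps_coord {v : Site d} (hv : v ∈ steps d) (i : Fin d) : |v i| ≤ 1 := by
  have h1 := (mem_steps v).mp hv
  have h2 : v i ^ 2 ≤ 1 := (Finset.single_le_sum (f := fun i => v i ^ 2)
    (fun j _ => sq_nonneg _) (Finset.mem_univ i)).trans h1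
  exact sq_le_one_iff_abs_le_one _ |>.mp h2

theorem stepKernel_eq_zero (ω : Env d) {y z : Site d} {i : Fin d} (h : ¬|z i - y i| ≤ 1) :
    stepKernel ω y {z} = 0 := by
  change (∑ v : steps d, ENNReal.ofReal (ω y v) • Measure.dirac (y + (v : Site d))) _ = 0
  simp only [Measure.coe_finsetSum, Finset.sum_apply, Measure.smul_apply, smul_eq_mul]
  refine Finset.sum_eq_zero fun v _ => ?_
  rw [Measure.dirac_apply' _ (.of_discrete), Set.indicator_of_notMem, mul_zero]
  rintro rfl
  refine h ?_
  simpa using steps_coord v.2 i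

/-- The walk starts at the origin and moves to nearest neighbours. -/
theorem pathLaw_not_nearest_neighbour [NeZero d] (P : Measure (Env d)) [IsProbabilityMeasure P] :
    pathLaw P {X | ¬(X 0 0 = 0 ∧ ∀ n, |X (n + 1) 0 - X n 0| ≤ 1)} = 0 := by
  set B₀ : Set (ℕ → Site d) := {X | X 0 0 ≠ 0} with hB₀
  set B : ℕ → Set (ℕ → Site d) := fun n => {X | ¬|X (n + 1) 0 - X n 0| ≤ 1} with hB
  have hdet₀ : DeterminedBy 0 B₀ := fun X Y h hX => by
    rw [hB₀, Set.mem_ofPred_eq, ← h 0 le_rfl]; exact hX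
  have hdet : ∀ n, DeterminedBy (n + 1) (B n) := fun n X Y h hX => by
    simp only [hB, Set.mem_ofPred_eq] at hX ⊢
    rw [← h (n + 1) le_rfl, ← h n (Nat.le_succ n)]; exact hX
  refine measure_mono_null (t := B₀ ∪ ⋃ n, B n) (fun X hX => ?_)
    (measure_union_null ?_ (measure_iUnion_null fun n => ?_))
  · by_cases h0 : X 0 0 = 0
    · right
      have : ∃ n, ¬|X (n + 1) 0 - X n 0| ≤ 1 := by
        by_contra! hcon
        exact hX ⟨h0, hcon⟩
      exact Set.mem_iUnion.mpr this
    · exact Or.inl h0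
  · rw [pathLaw_apply P hdet₀.measurableSet]
    refine (lintegral_congr fun ω => ?_).trans lintegral_zero
    rw [hdet₀.measure_eq_tsum]
    refine ENNReal.tsum_eq_zero.mpr fun γ => ?_
    rw [quenchedLaw_cyl, if_neg]
    intro h0
    exact γ.2 (by rw [h0]; rfl)
  · rw [pathLaw_apply P (hdet n).measurableSet]
    refine (lintegral_congr fun ω => ?_).trans lintegral_zero
    rw [(hdet n).measure_eq_tsum]
    refine ENNReal.tsum_eq_zero.mpr fun γ => ?_
    rw [quenchedLaw_cyl, weight, Finset.prod_range_succ, stepKernel_eq_zero ω γ.2, mul_zero,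
      ite_self]

theorem exists_frequently_firstHit [NeZero d] {X : ℕ → Site d} (hX0 : X 0 0 = 0)
    (hX : ∀ n, |X (n + 1) 0 - X n 0| ≤ 1) (hspeed : 0 < upperSpeed X) :
    ∃ A : ℕ, 0 < A ∧ ∃ᶠ n : ℕ in atTop, ∃ t, FirstHit X n t ∧ t ≤ A * n := by
  obtain ⟨b, hb0, hb⟩ := EReal.lt_iff_exists_real_btwn.mp hspeed
  have hb0' : 0 < b := by exact_mod_cast hb0
  have hfreq := frequently_lt_of_lt_limsup (by isBoundedDefault) hb
  obtain ⟨A, hA⟩ := exists_nat_ge b⁻¹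
  have hA0 : 0 < A := by
    have : (0 : ℝ) < A := (inv_pos.mpr hb0').trans_le hA
    exact_mod_cast this
  have hAb : 1 ≤ A * b := by
    have := mul_le_mul_of_nonneg_right hA hb0'.le
    rwa [inv_mul_cancel₀ hb0'.ne'] at this
  refine ⟨A, hA0, frequently_atTop.mpr fun N => ?_⟩
  -- The level sought is `n = X k 0`. As `A b ≥ 1`, it satisfies `k < A n`, and `k > A N` then
  -- forces `n ≥ N`.
  obtain ⟨k, hk, hlt⟩ := frequently_atTop.mp hfreq (A * N + 1)
  have hlt' : b < (X k 0 : ℝ) / k := by exact_mod_cast hlt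
  have hk0 : (0 : ℝ) < k := by
    have : 0 < k := by omega
    exact_mod_cast this
  rw [lt_div_iff₀ hk0] at hlt'
  have hkA : (k : ℝ) < A * (X k 0 : ℝ) := by
    have hApos : (0 : ℝ) < A := by exact_mod_cast hA0
    nlinarith
  have hkA' : (k : ℤ) < A * X k 0 := by exact_mod_cast hkA
  have hpos : 0 < X k 0 := by
    by_contra! hneg
    have : (A : ℤ) * X k 0 ≤ 0 := mul_nonpos_of_nonneg_of_nonpos (by positivity) hneg
    omega
  obtain ⟨n, hn⟩ := Int.eq_ofNat_of_zero_le hpos.le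
  rw [hn] at hkA'
  have hkn : k < A * n := by exact_mod_cast hkA'
  obtain ⟨t, htk, ht⟩ := exists_firstHit (m := n) (k := k) hX (by omega) hn.ge
  refine ⟨n, ?_, t, ht, by omega⟩
  have h1 : A * N < A * n := by omega
  exact (Nat.lt_of_mul_lt_mul_left h1).le

/-- If `R` is almost surely finite, then the speed cannot be positive. -/
theorem pathLaw_upperSpeed_eq_zero [NeZero d] {P : Measure (Env d)} [IsProbabilityMeasure P]
    (hinv : TranslationInvariant P) (hG : ConditionG P)
    (hnull : ∀ c : ℝ, 0 < c → annealedLaw P 0 {p | timeR c p.2 = ⊤} = 0) :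
    pathLaw P {X | 0 < upperSpeed X} = 0 := by
  classical
  have hscale : ∀ A h : ℕ, ∃ L ≥ h, pathLaw P {X : ℕ → Site d | ∃ᶠ n in atTop,
      n < 4 * ((Finset.range n).filter fun m : ℕ => X ∈ goodFrom h L (8 * A) m).card} = 0 := by
    intro A h
    obtain ⟨L, hL, hle⟩ := exists_good_unlikely hinv hG hnull h (8 * A)
      (ε := 2⁻¹ ^ 5) (ENNReal.pow_pos (by simp) 5) (h + 1)
    refine ⟨L, by omega, ?_⟩
    convert ae_eventually_card_le (μ := pathLaw P) (G := fun m : ℕ => goodFrom h L (8 * A) m)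
      (L := L) (by omega) fun S hS => pathLaw_biInter_goodFrom_le hle S hS
  choose ℓ hℓ hnullℓ using hscale
  -- The scales are built recursively, since the admissible length `ℓ A h` depends on the permitted
  -- backtracking `h`. Doubling gives the separation that `exists_many_good` requires.
  set hs : ℕ → ℕ → ℕ := fun A i => Nat.rec 1 (fun _ h => 2 * ℓ A h) i with hhs
  have hs1 : ∀ A i, 1 ≤ hs A i := by
    intro A i
    induction i with
    | zero => exact le_rfl
    | succ i ih =>
      have := hℓ A (hs A i)
      change 1 ≤ 2 * ℓ A (hs A i)
      omega
  refine measure_mono_null (t := {X | ¬(X 0 0 = 0 ∧ ∀ n, |X (n + 1) 0 - X n 0| ≤ 1)} ∪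
    ⋃ A : ℕ, ⋃ i : ℕ, {X : ℕ → Site d | ∃ᶠ n in atTop, n < 4 * ((Finset.range n).filter
      fun m : ℕ => X ∈ goodFrom (hs A i) (ℓ A (hs A i)) (8 * A) m).card}) (fun X hX => ?_)
    (measure_union_null (pathLaw_not_nearest_neighbour P) (measure_iUnion_null fun A =>
      measure_iUnion_null fun i => hnullℓ A _))
  by_cases hnn : X 0 0 = 0 ∧ ∀ n, |X (n + 1) 0 - X n 0| ≤ 1
  swap
  · exact Or.inl hnn
  right
  obtain ⟨A, hA, hfreq⟩ := exists_frequently_firstHit hnn.1 hnn.2 hX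
  refine Set.mem_iUnion.mpr ⟨A, ?_⟩
  by_contra hcon
  have hev : ∀ i, ∀ᶠ n in atTop, ¬n < 4 * ((Finset.range n).filter
      fun m : ℕ => X ∈ goodFrom (hs A i) (ℓ A (hs A i)) (8 * A) m).card := fun i =>
    not_frequently.mp fun hi => hcon (Set.mem_iUnion.mpr ⟨i, hi⟩)
  have hev' : ∀ᶠ n in atTop, ∀ i ∈ Finset.range (8 * A), ¬n < 4 * ((Finset.range n).filter
      fun m : ℕ => X ∈ goodFrom (hs A i) (ℓ A (hs A i)) (8 * A) m).card :=
    (Finset.eventually_all _).mpr fun i _ => hev i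
  have hlarge : ∀ᶠ n in atTop, ∀ i ∈ Finset.range (8 * A), 4 * ℓ A (hs A i) < n :=
    (Finset.eventually_all _).mpr fun i _ => eventually_gt_atTop _
  obtain ⟨n, ⟨t, ht, htA⟩, hn, hnl⟩ := (hfreq.and_eventually (hev'.and hlarge)).exists
  obtain ⟨i, hi, hlt⟩ := exists_many_good hnn.1 hnn.2 hA ht htA (h := hs A)
    (L := fun i => ℓ A (hs A i)) (hs1 A) (fun i => hℓ A _) (fun i => le_rfl)
    fun i hi => hnl i (Finset.mem_range.mpr hi)
  refine hn i (Finset.mem_range.mpr hi) ?_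
  convert hlt

/-- Passing to a measurable hull avoids any measurability requirement on `B`. -/
theorem annealedLaw_eq_zero {P : Measure (Env d)} [IsProbabilityMeasure P]
    {B : Set (ℕ → Site d)} (hB : pathLaw P B = 0) : annealedLaw P 0 {p | p.2 ∈ B} = 0 := by
  have hm := measurableSet_toMeasurable (pathLaw P) B
  refine measure_mono_null (t := {p | p.2 ∈ toMeasurable (pathLaw P) B})
    (fun p hp => subset_toMeasurable _ _ hp) ?_
  have h1 := Measure.compProd_apply (μ := P) (κ := quenchedKernel (0 : Site d)) (measurable_snd hm)
  refine h1.trans ?_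
  rw [← hB, ← measure_toMeasurable B, pathLaw_apply P hm]
  rfl

end

end RWRE

theorem theorem2p2 (d : ℕ) [NeZero d] (P : MeasureTheory.Measure (RWRE.Env d))
    [MeasureTheory.IsProbabilityMeasure P]
    (hinv : RWRE.TranslationInvariant P)
    (hell : RWRE.UniformlyElliptic P)
    (hG : RWRE.ConditionG P)
    (hspeed : 0 < RWRE.annealedLaw P 0 {p | 0 < RWRE.upperSpeed p.2}) :
    ∃ c₅ : ℝ, 0 < c₅ ∧ 0 < RWRE.annealedLaw P 0 {p | RWRE.timeR c₅ p.2 = ⊤} := by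
  by_contra! hcon
  have hnull : ∀ c : ℝ, 0 < c → RWRE.annealedLaw P 0 {p | RWRE.timeR c p.2 = ⊤} = 0 :=
    fun c hc => nonpos_iff_eq_zero.mp (hcon c hc)
  exact hspeed.ne' (RWRE.annealedLaw_eq_zero (RWRE.pathLaw_upperSpeed_eq_zero hinv hG hnull))
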